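/- Let $K$ be a field of characteristic $0$, let $P$ (the ports) and $E$ be disjoint finite sets, $S=P\sqcup E$, and let $g_e,r_e\in K$ for $e\in E$; write $g_A=\prod_{e\in A}g_e$, $r_A=\prod_{e\in A}r_e$ and $\bar A=E\setminus A$ for $A\subseteq E$. Let $\epsilon$ be a ground set orientation, i.e. an alternating function from sequences over $S$ to $\{0,1,-1\}$ that is non-zero on sequences of distinct elements and has $\epsilon(\emptyset)=1$. Fix an ordering of each of $P$ and $E$, so that $P$, $E$ also denote sequences and $PE$ their concatenation. **Extensors.** For a finite set $T$, an element $\mathbf N$ of the exterior algebra of $KT$ and a sequence $A$ over $T$, $\mathbf N[A]$ denotes the coordinate of $\mathbf N$ at $A$ (alternating in $A$). An extensor is a decomposable element, i.e. a scalar multiple of an exterior product of vectors. For $\mathbf N$ in the exterior algebra of $KS$ let $\mathbf N^{\perp}[X]=\mathbf N[S\setminus X]\,\epsilon((S\setminus X)\,X)$. Let $P_\iota,P_\upsilon$ be disjoint copies of $P$, and let $\iota_g,\upsilon_r$ be the algebra maps induced by $\iota_g(e)=g_e e$, $\iota_g(p)=p_\iota$, $\upsilon_r(e)=r_e e$, $\upsilon_r(p)=p_\upsilon$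 ($e\in E$, $p\in P$). Put $\mathbf M(\mathbf N)=\iota_g(\mathbf N)\,\upsilon_r(\mathbf N^\perp)$, and let $\mathbf M_E(\mathbf N)$ be the element of the exterior algebra of $K(P_\iota\sqcup P_\upsilon)$ with coordinates $\mathbf M_E(\mathbf N)[X]=\mathbf M(\mathbf N)[XE]$. For an element of the exterior algebra of $KP$, the same definition with $E=\emptyset$ and the restriction of $\epsilon$ to $P$ gives $\mathbf M_\emptyset$. **Oriented matroids.** An oriented matroid is a pair $\{\chi,-\chi\}$ of chirotopes. A unimodular presentation of an oriented matroid is an extensor with all coordinates in $\{0,1,-1\}$ whose coordinates form one of its chirotopes; an oriented matroid is unimodular (regular) if it has such a presentation over $\mathbb Q$. For a unimodular oriented matroid $\mathcal N$ on $S$ define $\mathbf M_E(\mathcal N)=\mathbf M_E(\mathbf N)$, where $\mathbf N$ is a unimodular presentation of $\mathcal N$ over $K$; similarly $\mathbf M_\emptyset(\mathcal N')$ for a unimodular $\mathcal N'$ on $P$. **Corank-nullity polynomial.** For an oriented matroid $\mathcal N$ on $S$ let $$R(\mathcal N)=\sum_{A\subseteq E}[\mathcal N/A|P]\;g_A\,r_{\bar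 A}\;u^{\rho\mathcal N-\rho[\mathcal N/A|P]-\rho A}\;v^{|A|-\rho A},$$ where $\rho$ is rank, $\mathcal N/A|P$ is the oriented minor on $P$ obtained by contracting $A$ and deleting $\bar A$, and for an oriented matroid $\mathcal N'$ on $P$ the symbol $[\mathcal N']$ is the monomial that is the (commutative) product of the variables attached to the connected components of $\mathcal N'$, with one variable for each connected oriented matroid on a subset of $P$. **Theorem.** Let $\mathcal N$ be a unimodular oriented matroid on $S=P\sqcup E$. Then $\mathcal N$ has a unimodular presentation over $K$, and $\mathbf M_E(\mathcal N)$ does not depend on the choice of the presentation. The substitution that replaces, $K$-linearly, each monomial $[\mathcal N']$, for $\mathcal N'$ a unimodular oriented matroid on $P$, by the extensor $\epsilon(P)\,\epsilon(PE)\,\mathbf M_\emptyset(\mathcal N')$ is well defined, and $\mathbf M_E(\mathcal N)$ is the result of setting $u=v=0$ in $R(\mathcal N)$ and then making this substitution. -/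

import Mathlib

/-! ### Sequences and alternating sign functions -/

/-- A sign-valued function of sequences is alternating: `f(x_σ) = sign(σ) f(x)`. -/
def IsAlternatingSign {S : Type*} (f : List S → SignType) : Prop :=
  ∀ (n : ℕ) (x : Fin n → S) (σ : Equiv.Perm (Fin n)),
    f (List.ofFn (x ∘ σ)) = SignType.sign ((Equiv.Perm.sign σ : ℤˣ) : ℤ) * f (List.ofFn x)

namespace IsAlternatingSign

variable {S T : Type*} {f : List S → SignType}

theorem neg (h : IsAlternatingSign f) : IsAlternatingSign (fun A => -f A) := by
  intro n x σ
  simp only [h n x σ, mul_neg]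

theorem map_append (h : IsAlternatingSign f) (j : T → S) (Z : List S) :
    IsAlternatingSign (fun A : List T => f (A.map j ++ Z)) := by
  intro n x σ
  have key : ∀ y : Fin n → T,
      (List.ofFn y).map j ++ Z = List.ofFn (Fin.append (j ∘ y) Z.get) := by
    intro y
    rw [List.ofFn_fin_append, List.map_ofFn, List.ofFn_get]
  let τ : Equiv.Perm (Fin (n + Z.length)) :=
    finSumFinEquiv.permCongr (Equiv.Perm.sumCongr σ 1)
  have hτ : Fin.append (j ∘ (x ∘ σ)) Z.get = Fin.append (j ∘ x) Z.get ∘ τ := by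
    funext i
    refine Fin.addCases (fun i => ?_) (fun i => ?_) i
    · simp [τ, Equiv.permCongr_apply]
    · simp [τ, Equiv.permCongr_apply]
  have hs : Equiv.Perm.sign τ = Equiv.Perm.sign σ := by
    simp [τ]
  simp only [key]
  rw [hτ, h, hs]

theorem swap (h : IsAlternatingSign f) (A : List S) (a b : S) (B : List S) :
    f (A ++ a :: b :: B) = -f (A ++ b :: a :: B) := by
  set L := A ++ b :: a :: B with hL
  have hlen : L.length = A.length + (B.length + 2) := by simp [hL]
  let i : Fin L.length := ⟨A.length, by omega⟩
  let k : Fin L.length := ⟨A.length + 1, by omega⟩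
  have hik : i ≠ k := by simp [i, k]
  have h1 := h L.length L.get (Equiv.swap i k)
  have h2 : List.ofFn (L.get ∘ Equiv.swap i k) = A ++ a :: b :: B := by
    apply List.ext_getElem
    · simp [hL, Nat.add_assoc]
    · intro m hm1 hm2
      simp only [List.getElem_ofFn, Function.comp_apply]
      rcases lt_trichotomy m A.length with hm | hm | hm
      · rw [Equiv.swap_apply_of_ne_of_ne]
        · simp [hL, List.getElem_append_left, hm]
        · simp [i, Fin.ext_iff]; omega
        · simp [k, Fin.ext_iff]; omega
      · subst hm
        have : (⟨A.length, by simpa using hm1⟩ : Fin L.length) = i := rfl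
        rw [this, Equiv.swap_apply_left]
        simp [hL, k, List.getElem_append_right]
      · rcases Nat.lt_or_ge (A.length + 1) m with hm' | hm'
        · rw [Equiv.swap_apply_of_ne_of_ne]
          · obtain ⟨q, rfl⟩ : ∃ q, m = A.length + (q + 2) := ⟨m - A.length - 2, by omega⟩
            simp [hL, List.getElem_append_right]
          · simp [i, Fin.ext_iff]; omega
          · simp [k, Fin.ext_iff]; omega
        · obtain rfl : m = A.length + 1 := by omega
          have : (⟨A.length + 1, by simpa using hm1⟩ : Fin L.length) = k := rfl
          rw [this, Equiv.swap_apply_right]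
          simp [hL, i, List.getElem_append_right]
  rw [h2, List.ofFn_get, Equiv.Perm.sign_swap hik] at h1
  rw [h1]
  simp

theorem perm_eq_or (h : IsAlternatingSign f) {A B : List S} (hAB : A.Perm B) :
    f A = f B ∨ f A = -f B := by
  have key : ∀ L : List S, f (L ++ A) = f (L ++ B) ∨ f (L ++ A) = -f (L ++ B) := by
    induction hAB with
    | nil => exact fun L => Or.inl rfl
    | cons x _ ih =>
      intro L
      simpa using ih (L ++ [x])
    | swap x y l => exact fun L => Or.inr (h.swap L y x l)
    | trans _ _ ih1 ih2 =>
      intro L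
      rcases ih1 L with h1 | h1 <;> rcases ih2 L with h2 | h2 <;> simp [h1, h2]
  simpa using key []

theorem ne_zero_of_perm (h : IsAlternatingSign f) {A B : List S} (hAB : A.Perm B)
    (hA : f A ≠ 0) : f B ≠ 0 := by
  intro hB
  rcases h.perm_eq_or hAB with h1 | h1 <;> simp [hB] at h1 <;> exact hA h1

theorem nodup (h : IsAlternatingSign f) {A : List S} (hA : f A ≠ 0) : A.Nodup := by
  rw [List.nodup_iff_sublist]
  intro a ha
  obtain ⟨l, hl⟩ := ha.exists_perm_append
  have h1 := h.ne_zero_of_perm hl hA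
  have h2 := h.swap [] a a l
  simp only [List.nil_append, List.cons_append] at h1 h2
  revert h1 h2
  generalize f (a :: a :: l) = s
  revert s
  decide

end IsAlternatingSign

/-! ### Chirotopes -/

/-- A chirotope on the ground set `S`, as a function of sequences over `S` that vanishes on all
sequences whose length is not the rank. -/
structure Chirotope (S : Type*) where
  toFun : List S → SignType
  length_eq : ∀ A B, toFun A ≠ 0 → toFun B ≠ 0 → A.length = B.length
  exists_ne_zero : ∃ A, toFun A ≠ 0
  alternating : IsAlternatingSign toFun
  /-- For `x = aX` and `Y = y₁ ⋯ y_r`: if `χ(yᵢX) χ(y₁ ⋯ yᵢ₋₁ a yᵢ₊₁ ⋯ y_r) ≥ 0` for all `i`, then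
  `χ(aX) χ(Y) ≥ 0`. -/
  exchange : ∀ (a : S) (X Y : List S),
    (∀ (Y₁ : List S) (y : S) (Y₂ : List S), Y = Y₁ ++ y :: Y₂ →
      0 ≤ toFun (y :: X) * toFun (Y₁ ++ a :: Y₂)) →
    0 ≤ toFun (a :: X) * toFun Y

namespace Chirotope

variable {S T : Type*}

@[ext] theorem ext {χ ψ : Chirotope S} (h : χ.toFun = ψ.toFun) : χ = ψ := by
  cases χ; cases ψ; cases h; rfl

/-- The opposite chirotope. -/
def neg (χ : Chirotope S) : Chirotope S where
  toFun A := -χ.toFun A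
  length_eq A B hA hB := χ.length_eq A B (by simpa using hA) (by simpa using hB)
  exists_ne_zero := by simpa using χ.exists_ne_zero
  alternating := χ.alternating.neg
  exchange a X Y h := by
    simp only [neg_mul_neg] at h ⊢
    exact χ.exchange a X Y h

/-- `B` is the set of elements of a sequence on which the chirotope does not vanish. -/
def IsBase (χ : Chirotope S) (B : Set S) : Prop :=
  ∃ A : List S, {x | x ∈ A} = B ∧ χ.toFun A ≠ 0

theorem exchangeProperty (χ : Chirotope S) : Matroid.ExchangeProperty χ.IsBase := by
  rintro _ _ ⟨A, rfl, hA⟩ ⟨Y, rfl, hY⟩ a ⟨ha, haY⟩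
  simp only [Set.mem_ofPred_eq] at ha haY
  obtain ⟨X, hX⟩ : ∃ X, A.Perm (a :: X) := by
    obtain ⟨s, t, rfl⟩ := List.append_of_mem ha
    exact ⟨s ++ t, List.perm_middle⟩
  have hA' := χ.alternating.ne_zero_of_perm hX hA
  have hnd := χ.alternating.nodup hA'
  have hset : ({x | x ∈ A} : Set S) \ {a} = {x | x ∈ X} := by
    ext x
    simp only [Set.mem_sdiff, Set.mem_ofPred_eq, Set.mem_singleton_iff, hX.mem_iff, List.mem_cons]
    constructor
    · rintro ⟨h1 | h1, h2⟩
      · exact absurd h1 h2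
      · exact h1
    · intro h
      refine ⟨Or.inr h, ?_⟩
      rintro rfl
      exact (List.nodup_cons.1 hnd).1 h
  rw [hset]
  by_contra hcon
  have hzero : ∀ y ∈ Y, χ.toFun (y :: X) = 0 := by
    intro y hy
    by_contra hne
    refine hcon ⟨y, ⟨hy, ?_⟩, y :: X, ?_, hne⟩
    · simp only [Set.mem_ofPred_eq, hX.mem_iff, List.mem_cons]
      rintro (rfl | h)
      · exact haY hy
      · exact (List.nodup_cons.1 (χ.alternating.nodup hne)).1 h
    · ext x; simp
  have hpos : ∀ Y' : List S, (∀ y ∈ Y', y ∈ Y) → 0 ≤ χ.toFun (a :: X) * χ.toFun Y' := by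
    intro Y' hY'
    apply χ.exchange
    rintro Y₁ y Y₂ rfl
    rw [hzero y (hY' y (by simp)), zero_mul]
  have hlen := χ.length_eq _ _ hA' hY
  match Y, hlen with
  | [y], hlen =>
    have : X = [] := by simpa using hlen
    subst this
    exact hY (hzero y (by simp))
  | y :: z :: Y, _ =>
    have h1 := hpos (y :: z :: Y) (by simp)
    have h2 := hpos (z :: y :: Y) (by simp; tauto)
    have h3 := χ.alternating.swap [] y z Y
    simp only [List.nil_append] at h3
    revert h1 h2 h3 hA' hY
    generalize χ.toFun (a :: X) = s
    generalize χ.toFun (y :: z :: Y) = t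
    generalize χ.toFun (z :: y :: Y) = u
    revert s t u
    decide

/-- The underlying matroid of a chirotope. -/
def matroid [Finite S] (χ : Chirotope S) : Matroid S :=
  Matroid.ofIsBaseOfFinite (E := Set.univ) Set.finite_univ χ.IsBase
    (by obtain ⟨A, hA⟩ := χ.exists_ne_zero; exact ⟨_, A, rfl, hA⟩)
    χ.exchangeProperty (fun _ _ => Set.subset_univ _)

theorem matroid_isBase [Finite S] (χ : Chirotope S) (A : List S) (hA : A.Nodup) :
    χ.matroid.IsBase {x | x ∈ A} ↔ χ.toFun A ≠ 0 := by
  change χ.IsBase _ ↔ _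
  constructor
  · rintro ⟨B, hB, hne⟩
    refine χ.alternating.ne_zero_of_perm ?_ hne
    rw [List.perm_ext_iff_of_nodup (χ.alternating.nodup hne) hA]
    intro x
    exact Set.ext_iff.1 hB x
  · exact fun h => ⟨A, rfl, h⟩

theorem matroid_neg [Finite S] (χ : Chirotope S) : χ.neg.matroid = χ.matroid := by
  have : χ.neg.IsBase = χ.IsBase := by
    funext B
    simp [IsBase, neg]
  unfold matroid
  congr 1

end Chirotope

/-! ### Minors -/

/-- `Z` is a sequence `DB` where `B` is a basis of `C`, and `D` completes the bases of
`C ∪ j(T)` that contain `B` to bases of the whole matroid. Then `X ↦ χ(j(X) Z)` is a chirotope of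
the minor with ground set `T` obtained by contracting `C` and deleting all the other elements. -/
def IsMinorSequence {S T : Type*} (M : Matroid S) (j : T → S) (C : Set S) (Z : List S) : Prop :=
  ∃ (X : List T) (D B : List S), Z = D ++ B ∧ (X.map j ++ Z).Nodup ∧
    M.IsBasis {x | x ∈ B} C ∧
    M.IsBasis {x | x ∈ X.map j ++ B} (C ∪ Set.range j) ∧
    M.IsBase {x | x ∈ X.map j ++ Z}

theorem exists_isMinorSequence {S T : Type*} [Finite S] (M : Matroid S) (hE : M.E = Set.univ)
    (j : T → S) (C : Set S) : ∃ Z, IsMinorSequence M j C Z := by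
  classical
  have list_of : ∀ U : Set S, ∃ L : List S, L.Nodup ∧ ∀ x, x ∈ L ↔ x ∈ U := by
    intro U
    exact ⟨(Set.toFinite U).toFinset.toList, Finset.nodup_toList _, by simp⟩
  obtain ⟨B₀, hB₀⟩ := M.exists_isBasis C (by simp [hE])
  obtain ⟨B₁, hB₁, h01⟩ := hB₀.indep.subset_isBasis_of_subset
    (hB₀.subset.trans (Set.subset_union_left (t := Set.range j))) (by simp [hE])
  obtain ⟨B₂, hB₂, h12⟩ := hB₁.indep.exists_isBase_superset
  obtain ⟨B, hBn, hB⟩ := list_of B₀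
  obtain ⟨D, hDn, hD⟩ := list_of (B₂ \ B₁)
  obtain ⟨X₀, hXn, hX⟩ := list_of (B₁ \ B₀)
  have hrange : ∀ x ∈ X₀, ∃ t, j t = x := by
    intro x hx
    obtain ⟨h1, h0⟩ := (hX x).1 hx
    rcases hB₁.subset h1 with hC | hj
    · exact absurd (hB₀.mem_of_insert_indep hC
        (hB₁.indep.subset (Set.insert_subset h1 h01))) h0
    · exact hj
  obtain ⟨X, hXX⟩ : ∃ X : List T, X.map j = X₀ := by
    have : X₀ ∈ Set.range (List.map j) := by
      rw [Set.range_list_map]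
      exact hrange
    exact this
  refine ⟨D ++ B, X, D, B, rfl, ?_, ?_, ?_, ?_⟩
  · rw [hXX, List.nodup_append', List.nodup_append']
    refine ⟨hXn, ⟨hDn, hBn, ?_⟩, ?_⟩
    · intro x hx hx'
      exact ((hD x).1 hx).2 (h01 ((hB x).1 hx'))
    · intro x hx hx'
      rcases List.mem_append.1 hx' with h | h
      · exact ((hD x).1 h).2 ((hX x).1 hx).1
      · exact ((hX x).1 hx).2 ((hB x).1 h)
  · convert hB₀ using 1
    ext x; exact hB x
  · convert hB₁ using 1
    ext x
    simp only [hXX, List.mem_append, hX, hB, Set.mem_ofPred_eq, Set.mem_sdiff]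
    have := @h01 x
    tauto
  · convert hB₂ using 1
    ext x
    simp only [hXX, List.mem_append, hX, hB, hD, Set.mem_ofPred_eq, Set.mem_sdiff]
    have := @h01 x
    have := @h12 x
    tauto

namespace Chirotope

variable {S T : Type*}

/-- A chirotope of the minor of `χ` with ground set `T` (placed in `S` by the injection `j`)
obtained by contracting `C` and deleting all elements outside `j(T) ∪ C`. It is determined up to
a sign. -/
noncomputable def minor [Finite S] (χ : Chirotope S) (j : T → S) (C : Set S) : Chirotope T :=
  let Z := Classical.choose (exists_isMinorSequence χ.matroid rfl j C)
  { toFun := fun X => χ.toFun (X.map j ++ Z)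
    length_eq := fun A B hA hB => by simpa using χ.length_eq _ _ hA hB
    exists_ne_zero := by
      obtain ⟨X, D, B, hZ, hn, -, -, hX⟩ :=
        Classical.choose_spec (exists_isMinorSequence χ.matroid rfl j C)
      exact ⟨X, (χ.matroid_isBase _ hn).1 hX⟩
    alternating := χ.alternating.map_append j Z
    exchange := by
      intro a X Y h
      simp only [List.map_cons, List.cons_append]
      apply χ.exchange
      intro Y₁ y Y₂ hY
      rw [List.append_eq_append_iff] at hY
      have hmem : y ∈ Z → 0 ≤ χ.toFun (y :: (X.map j ++ Z)) * χ.toFun (Y₁ ++ j a :: Y₂) := by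
        intro hy
        have : χ.toFun (y :: (X.map j ++ Z)) = 0 := by
          by_contra hne
          exact (List.nodup_cons.1 (χ.alternating.nodup hne)).1 (by simp [hy])
        rw [this, zero_mul]
      rcases hY with ⟨W, rfl, hW⟩ | ⟨W, hW, hW'⟩
      · exact hmem (by rw [hW]; simp)
      · cases W with
        | nil =>
          exact hmem (by simp only [List.nil_append] at hW'; rw [← hW']; simp)
        | cons w W =>
          simp only [List.cons_append, List.cons.injEq] at hW'
          obtain ⟨rfl, rfl⟩ := hW'
          obtain ⟨U₁, U', rfl, rfl, hU'⟩ := List.map_eq_append_iff.1 hW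
          obtain ⟨u, U₂, rfl, rfl, rfl⟩ := List.map_eq_cons_iff.1 hU'
          simpa using h U₁ u U₂ rfl }

theorem minor_neg [Finite S] (χ : Chirotope S) (j : T → S) (C : Set S) :
    χ.neg.minor j C = (χ.minor j C).neg := by
  have key : ∀ (M M' : Matroid S) (hE : M.E = Set.univ) (hE' : M'.E = Set.univ), M = M' →
      Classical.choose (exists_isMinorSequence M hE j C) =
        Classical.choose (exists_isMinorSequence M' hE' j C) := by
    rintro M _ hE hE' rfl
    rfl
  ext1
  funext X
  change -χ.toFun (X.map j ++ Classical.choose _) = -χ.toFun (X.map j ++ Classical.choose _)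
  rw [key χ.neg.matroid χ.matroid rfl rfl χ.matroid_neg]

/-- Chirotopes that agree up to a global sign. -/
instance setoid (S : Type*) : Setoid (Chirotope S) where
  r χ ψ := χ = ψ ∨ χ = ψ.neg
  iseqv := by
    have nn : ∀ χ : Chirotope S, χ.neg.neg = χ := fun χ => by
      ext1; funext A; simp [neg]
    refine ⟨fun χ => Or.inl rfl, ?_, ?_⟩
    · rintro χ ψ (rfl | rfl)
      · exact Or.inl rfl
      · exact Or.inr (nn _).symm
    · rintro χ ψ φ (rfl | rfl) (rfl | rfl)
      · exact Or.inl rfl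
      · exact Or.inr rfl
      · exact Or.inr rfl
      · exact Or.inl (nn _)

end Chirotope

/-! ### Oriented matroids -/

/-- An oriented matroid on the ground set `S`: a pair `{χ, -χ}` of opposite chirotopes. -/
def OrientedMatroid (S : Type*) : Type _ := Quotient (Chirotope.setoid S)

namespace OrientedMatroid

variable {S T : Type*}

/-- The oriented matroid `{χ, -χ}`. -/
def ofChirotope (χ : Chirotope S) : OrientedMatroid S := Quotient.mk _ χ

/-- The underlying matroid. -/
def matroid [Finite S] (𝒩 : OrientedMatroid S) : Matroid S :=
  Quotient.lift Chirotope.matroid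
    (by rintro χ ψ (rfl | rfl); exacts [rfl, ψ.matroid_neg]) 𝒩

/-- The rank of a set of elements. -/
noncomputable def rk [Finite S] (𝒩 : OrientedMatroid S) (A : Set S) : ℕ :=
  (𝒩.matroid.eRk A).toNat

/-- The rank `ρ𝒩`. -/
noncomputable def rank [Finite S] (𝒩 : OrientedMatroid S) : ℕ := 𝒩.rk Set.univ

/-- The minor of `𝒩` with ground set `T` (placed in `S` by the injection `j`) obtained by
contracting `C` and deleting all elements outside `j(T) ∪ C`. -/
noncomputable def minor [Finite S] (𝒩 : OrientedMatroid S) (j : T → S) (C : Set S) :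
    OrientedMatroid T :=
  Quotient.lift (fun χ => ofChirotope (χ.minor j C))
    (by
      rintro χ ψ (rfl | rfl)
      · rfl
      · exact Quotient.sound (Or.inr (ψ.minor_neg j C))) 𝒩

/-- The restriction `𝒩|T`. -/
noncomputable def restrict [Finite S] (𝒩 : OrientedMatroid S) (T : Finset S) :
    OrientedMatroid T :=
  𝒩.minor Subtype.val ∅

/-- `T` is a separator: `ρ(T) + ρ(S \ T) = ρ(S)`. -/
def IsSeparator [Finite S] (𝒩 : OrientedMatroid S) (T : Finset S) : Prop :=
  𝒩.rk (T : Set S) + 𝒩.rk (T : Set S)ᶜ = 𝒩.rank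

open scoped Classical in
/-- The (ground sets of the) connected components: the minimal nonempty separators. -/
noncomputable def components [Fintype S] (𝒩 : OrientedMatroid S) : Finset (Finset S) :=
  Finset.univ.filter (Minimal fun T : Finset S => T.Nonempty ∧ 𝒩.IsSeparator T)

end OrientedMatroid

/-! ### Ground set orientations -/

/-- A ground set orientation `ε`. -/
structure GroundSetOrientation (S : Type*) where
  toFun : List S → SignType
  alternating : IsAlternatingSign toFun
  ne_zero : ∀ A : List S, A.Nodup → toFun A ≠ 0
  empty : toFun [] = 1

/-- The values of `ε` on the sequences over a subset of the ground set. -/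
def GroundSetOrientation.comap {S T : Type*} (ε : GroundSetOrientation S) (j : T → S)
    (hj : Function.Injective j) : GroundSetOrientation T where
  toFun A := ε.toFun (A.map j)
  alternating := by simpa using ε.alternating.map_append j []
  ne_zero A hA := ε.ne_zero _ (hA.map hj)
  empty := ε.empty

/-! ### Extensors -/

section Extensors

variable {K : Type*} [Field K] {S T : Type*} [DecidableEq S] [DecidableEq T]

/-- The exterior product `a₁ ⋯ a_k` of the basis vectors named by a sequence `A = a₁ ⋯ a_k`. -/
def extProd (K : Type*) [Field K] (A : List S) : ExteriorAlgebra K (S → K) :=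
  (A.map fun a => ExteriorAlgebra.ι K (Pi.single a (1 : K) : S → K)).prod

/-- The coordinate `X[A]`: the linear functional on the exterior algebra of `K S` that takes the
value `det (vᵢ(aⱼ))` on `v₁ ⋯ v_k` for `A = a₁ ⋯ a_k`, and vanishes in all degrees other
than `k`. -/
def coord (A : List S) : ExteriorAlgebra K (S → K) →ₗ[K] K :=
  ExteriorAlgebra.liftAlternating
    (Pi.single A.length
      ((Matrix.detRowAlternating (n := Fin A.length) (R := K)).compLinearMap
        (LinearMap.funLeft K K A.get)) :
      (i : ℕ) → (S → K) [⋀^Fin i]→ₗ[K] K)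

/-- (Fully) decomposable elements: scalar multiples of exterior products of vectors. -/
def IsExtensor (N : ExteriorAlgebra K (S → K)) : Prop :=
  ∃ (α : K) (k : ℕ) (v : Fin k → S → K), N = α • ExteriorAlgebra.ιMulti K k v

/-- `N` is a unimodular presentation of `𝒩`: an extensor all of whose Plücker coordinates are in
`{0, 1, -1}`, and form a chirotope of `𝒩`. -/
def IsUnimodularPresentation (N : ExteriorAlgebra K (S → K)) (𝒩 : OrientedMatroid S) : Prop :=
  IsExtensor N ∧ ∃ χ : Chirotope S, OrientedMatroid.ofChirotope χ = 𝒩 ∧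
    ∀ A : List S, coord A N = (χ.toFun A : K)

/-- Unimodular (regular) oriented matroids. -/
def OrientedMatroid.IsUnimodular (𝒩 : OrientedMatroid S) : Prop :=
  ∃ N : ExteriorAlgebra ℚ (S → ℚ), IsUnimodularPresentation N 𝒩

/-- For a sequence `Z` over `S` and an injection `j : T → S` with image disjoint from `Z`, the
element of the exterior algebra of `K T` whose coordinates are `X ↦ N[j(X) Z]`: contract `Z` and
delete the remaining elements outside `j(T)`. -/
noncomputable def extMinor [Fintype T] (j : T → S) (Z : List S)
    (N : ExteriorAlgebra K (S → K)) : ExteriorAlgebra K (T → K) :=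
  ∑ X : Finset T, coord (X.toList.map j ++ Z) N • extProd K X.toList

/-- The dual `N^⊥[X] = N[X̄] ε(X̄ X)`. -/
noncomputable def dual [Fintype S] (ε : GroundSetOrientation S)
    (N : ExteriorAlgebra K (S → K)) : ExteriorAlgebra K (S → K) :=
  ∑ X : Finset S,
    (coord Xᶜ.toList N * (ε.toFun (Xᶜ.toList ++ X.toList) : K)) • extProd K X.toList

end Extensors

/-! ### The extensor `M_E`

The ground set with ports `P` and other elements `E` is `P ⊕ E`. In `(P ⊕ P) ⊕ E`, the first copy
of `P` is `P_ι` and the second copy is `P_υ`. -/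

section ME

variable {K : Type*} [Field K] {P E : Type*} [Fintype P] [Fintype E] [DecidableEq P]
  [DecidableEq E]

/-- `ι_g(e) = g_e e` for `e ∈ E` and `ι_g(p) = p_ι` for `p ∈ P`. -/
noncomputable def iotaMap (g : E → K) : (P ⊕ E → K) →ₗ[K] ((P ⊕ P) ⊕ E → K) :=
  (Pi.basisFun K (P ⊕ E)).constr K
    (Sum.elim (fun p => Pi.single (Sum.inl (Sum.inl p)) 1)
      (fun e => g e • Pi.single (Sum.inr e) 1))

/-- `υ_r(e) = r_e e` for `e ∈ E` and `υ_r(p) = p_υ` for `p ∈ P`. -/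
noncomputable def upsilonMap (r : E → K) : (P ⊕ E → K) →ₗ[K] ((P ⊕ P) ⊕ E → K) :=
  (Pi.basisFun K (P ⊕ E)).constr K
    (Sum.elim (fun p => Pi.single (Sum.inl (Sum.inr p)) 1)
      (fun e => r e • Pi.single (Sum.inr e) 1))

/-- `M(N) = ι_g(N) υ_r(N^⊥)`. -/
noncomputable def extM (ε : GroundSetOrientation (P ⊕ E)) (g r : E → K)
    (N : ExteriorAlgebra K (P ⊕ E → K)) : ExteriorAlgebra K ((P ⊕ P) ⊕ E → K) :=
  ExteriorAlgebra.map (iotaMap g) N * ExteriorAlgebra.map (upsilonMap r) (dual ε N)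

/-- `M_E(N) = M(N)/E`, where the sequence `e` lists the elements of `E`. -/
noncomputable def extME (ε : GroundSetOrientation (P ⊕ E)) (g r : E → K) (e : List E)
    (N : ExteriorAlgebra K (P ⊕ E → K)) : ExteriorAlgebra K (P ⊕ P → K) :=
  extMinor Sum.inl (e.map Sum.inr) (extM ε g r N)

open scoped Classical in
/-- `M_E(𝒩) = M_E(N)` for a unimodular presentation `N` of `𝒩`. -/
noncomputable def OrientedMatroid.ME (ε : GroundSetOrientation (P ⊕ E)) (g r : E → K)
    (e : List E) (𝒩 : OrientedMatroid (P ⊕ E)) : ExteriorAlgebra K (P ⊕ P → K) :=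
  if h : ∃ N : ExteriorAlgebra K (P ⊕ E → K), IsUnimodularPresentation N 𝒩 then
    extME ε g r e h.choose
  else 0

end ME

/-! ### The parametrized ported corank-nullity polynomial

An oriented matroid with ground set `P` is regarded as one on `P ⊕ Empty`, that is, as a ported
one with no other elements than ports. -/

section CorankNullity

/-- The variables other than the parameters: `u`, `v` and a variable for each oriented matroid on
a subset of `P`. (Only those of connected oriented matroids will occur.) -/
inductive RVar (P : Type*)
  | u : RVar P
  | v : RVar P
  | minor (T : Finset (P ⊕ Empty)) (𝒩 : OrientedMatroid T) : RVar P

variable {K : Type*} [Field K] {P E : Type*} [Fintype P] [Fintype E] [DecidableEq P]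
  [DecidableEq E]

/-- The inclusion of the ports in the ground set. -/
def portIncl (P E : Type*) : P ⊕ Empty → P ⊕ E := Sum.map id Empty.elim

theorem portIncl_injective (P E : Type*) : Function.Injective (portIncl P E) :=
  Function.injective_id.sumMap (fun x => x.elim)

/-- The monomial `[𝒩]`: the product of the variables of the connected components of `𝒩`. -/
noncomputable def bracket (K : Type*) [Field K] (𝒩 : OrientedMatroid (P ⊕ Empty)) :
    MvPolynomial (RVar P) K :=
  ∏ T ∈ 𝒩.components, MvPolynomial.X (RVar.minor T (𝒩.restrict T))

/-- The minor `𝒩/A|P`. -/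
noncomputable def OrientedMatroid.portMinor (𝒩 : OrientedMatroid (P ⊕ E)) (A : Finset E) :
    OrientedMatroid (P ⊕ Empty) :=
  𝒩.minor (portIncl P E) (Sum.inr '' (A : Set E))

/-- `R(𝒩) = ∑_{A ⊆ E} [𝒩/A|P] g_A r_{E \ A} u^{ρ𝒩 - ρ[𝒩/A|P] - ρA} v^{|A| - ρA}`. -/
noncomputable def corankNullity (g r : E → K) (𝒩 : OrientedMatroid (P ⊕ E)) :
    MvPolynomial (RVar P) K :=
  ∑ A : Finset E,
    bracket K (𝒩.portMinor A) * MvPolynomial.C ((∏ a ∈ A, g a) * ∏ a ∈ Aᶜ, r a) *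
      MvPolynomial.X RVar.u ^
        (𝒩.rank - (𝒩.portMinor A).rank - 𝒩.rk (Sum.inr '' (A : Set E))) *
      MvPolynomial.X RVar.v ^ (A.card - 𝒩.rk (Sum.inr '' (A : Set E)))

/-- The substitution `u = 0`, `v = 0`. -/
noncomputable def setUVZero : MvPolynomial (RVar P) K →ₐ[K] MvPolynomial (RVar P) K :=
  MvPolynomial.aeval fun
    | RVar.u => 0
    | RVar.v => 0
    | RVar.minor T 𝒩 => MvPolynomial.X (RVar.minor T 𝒩)

/-- `M_∅(𝒩)` for an oriented matroid `𝒩` on the ports. -/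
noncomputable def MEmpty (K : Type*) [Field K] (ε : GroundSetOrientation (P ⊕ E))
    (𝒩 : OrientedMatroid (P ⊕ Empty)) : ExteriorAlgebra K (P ⊕ P → K) :=
  𝒩.ME (ε.comap (portIncl P E) (portIncl_injective P E)) Empty.elim Empty.elim []

/-- The sign `ε(P) ε(PE)`, where the sequences `p` and `e` list the elements of `P` and `E`. -/
def portSign (ε : GroundSetOrientation (P ⊕ E)) (p : List P) (e : List E) : SignType :=
  ε.toFun (p.map Sum.inl) * ε.toFun (p.map Sum.inl ++ e.map Sum.inr)

open scoped Classical in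
/-- The `K`-linear replacement of each monomial `[𝒩]`, for `𝒩` a unimodular oriented matroid on
the ports, by the extensor `ε(P) ε(PE) M_∅(𝒩)`. (All other monomials are replaced by `0`.) -/
noncomputable def replaceMonomials (ε : GroundSetOrientation (P ⊕ E)) (p : List P) (e : List E) :
    MvPolynomial (RVar P) K →ₗ[K] ExteriorAlgebra K (P ⊕ P → K) :=
  (MvPolynomial.basisMonomials (RVar P) K).constr K fun m =>
    if h : ∃ 𝒩 : OrientedMatroid (P ⊕ Empty),
        𝒩.IsUnimodular ∧ bracket K 𝒩 = MvPolynomial.monomial m 1 then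
      (portSign ε p e : K) • MEmpty K ε h.choose
    else 0

end CorankNullity

/-! Expand `N` and its dual in coordinates indexed by `X ⊔ A` with `X ⊆ P`, `A ⊆ E`. In `ι_g(N)
υ_r(N^⊥)`, a product of the terms at `X ⊔ A` and `Y ⊔ B` contributes to coordinates of the form `[·
E]` only if `B = Ā`. Its coefficient is then `g_A r_Ā N[XA] N[ȲA]` times a sign, where `Ȳ = P \ Y`.
The numbers `N[XA]` are the coordinates of the minor `N/A|P`, so for fixed `A` the terms form `g_A
r_Ā M_∅(N/A|P)`, except that `ε(ȲYE)` stands where `M_∅` has `ε(ȲY)`. The product of these two signs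
is `ε(P) ε(PE)`, whatever `Y` is. This gives `extME_eq_sum_minors`, which holds for every element
`N` of the exterior algebra.

If `N` presents a unimodular `𝒩`, the minor `X ↦ N[XA]` is non-zero exactly when `A` is independent
and `P ∪ A` is spanning, that is, when both exponents in the term of `A` in `R(𝒩)` vanish; in that
case it presents `𝒩/A|P` (`IsUnimodularPresentation.portMinor`,
`IsUnimodularPresentation.extMinor_eq_zero`). Hence `u = v = 0` selects the right terms. The choice
of `N` is immaterial because presentations differ by a sign and `M` is quadratic.

The substitution is well defined because `[𝒩']` determines `𝒩'` (`bracket_injective`): the monomial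
reveals the components with their orientations, and a chirotope factors across a separator, so that
the components determine it up to a global sign (`OrientedMatroid.eq_of_components`). -/

/-! ### Alternating functions of sequences -/

/-- A function of sequences changes sign when two adjacent entries are swapped, and vanishes on
sequences with repeated entries. -/
structure AltOn {S M : Type*} [Neg M] [Zero M] (f : List S → M) : Prop where
  swap : ∀ A a b B, f (A ++ a :: b :: B) = -f (A ++ b :: a :: B)
  zero : ∀ A, ¬ A.Nodup → f A = 0

/-- An adjacent swap in a list is a transposition of indices, the form in which
`Matrix.det_permute'` yields the sign. -/
theorem exists_ofFn_swap {S : Type*} (A : List S) (a b : S) (B : List S) :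
    ∃ (n : ℕ) (x : Fin n → S) (i k : Fin n), i ≠ k ∧ List.ofFn x = A ++ b :: a :: B ∧
      List.ofFn (x ∘ Equiv.swap i k) = A ++ a :: b :: B := by
  set L := A ++ b :: a :: B with hL
  have hlen : L.length = A.length + (B.length + 2) := by simp [hL]
  let i : Fin L.length := ⟨A.length, by omega⟩
  let k : Fin L.length := ⟨A.length + 1, by omega⟩
  have hik : i ≠ k := by simp [i, k]
  refine ⟨L.length, L.get, i, k, hik, List.ofFn_get L, ?_⟩
  apply List.ext_getElem
  · simp [hL, Nat.add_assoc]
  · intro m hm1 hm2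
    simp only [List.getElem_ofFn, Function.comp_apply]
    rcases lt_trichotomy m A.length with hm | hm | hm
    · rw [Equiv.swap_apply_of_ne_of_ne]
      · simp [hL, List.getElem_append_left, hm]
      · simp [i, Fin.ext_iff]; omega
      · simp [k, Fin.ext_iff]; omega
    · subst hm
      have : (⟨A.length, by simpa using hm1⟩ : Fin L.length) = i := rfl
      rw [this, Equiv.swap_apply_left]
      simp [hL, k, List.getElem_append_right]
    · rcases Nat.lt_or_ge (A.length + 1) m with hm' | hm'
      · rw [Equiv.swap_apply_of_ne_of_ne]
        · obtain ⟨q, rfl⟩ : ∃ q, m = A.length + (q + 2) := ⟨m - A.length - 2, by omega⟩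
          simp [hL, List.getElem_append_right]
        · simp [i, Fin.ext_iff]; omega
        · simp [k, Fin.ext_iff]; omega
      · obtain rfl : m = A.length + 1 := by omega
        have : (⟨A.length + 1, by simpa using hm1⟩ : Fin L.length) = k := rfl
        rw [this, Equiv.swap_apply_right]
        simp [hL, i, List.getElem_append_right]

namespace AltOn

theorem context {S T M : Type*} [Neg M] [Zero M] {f : List S → M} (h : AltOn f) (L : List S)
    (j : T → S) (R : List S) : AltOn (fun A : List T => f (L ++ A.map j ++ R)) where
  swap A a b B := by
    simpa using h.swap (L ++ A.map j) (j a) (j b) (B.map j ++ R)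
  zero A hA := by
    refine h.zero _ fun hn => hA ?_
    exact ((List.nodup_append'.1 (List.nodup_append'.1 hn).1).2.1).of_map

theorem map_linear {S K M N : Type*} [Field K] [AddCommGroup M] [AddCommGroup N] [Module K M]
    [Module K N] {f : List S → M} (h : AltOn f) (φ : M →ₗ[K] N) : AltOn (fun A => φ (f A)) where
  swap A a b B := by rw [h.swap, map_neg]
  zero A hA := by rw [h.zero A hA, map_zero]

/-- The product of two alternating functions is symmetric. -/
theorem smul_perm {S K M : Type*} [Field K] [AddCommGroup M] [Module K M] {f : List S → K}
    {h : List S → M} (hf : AltOn f) (hh : AltOn h) {A B : List S} (hAB : A.Perm B) :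
    f A • h A = f B • h B := by
  -- The common prefix `L` is generalized to absorb the head in the `cons` case.
  have key : ∀ L : List S, f (L ++ A) • h (L ++ A) = f (L ++ B) • h (L ++ B) := by
    induction hAB with
    | nil => exact fun L => rfl
    | cons x _ ih =>
      intro L
      simpa using ih (L ++ [x])
    | swap x y l =>
      intro L
      rw [hf.swap, hh.swap, neg_smul_neg]
    | trans _ _ ih1 ih2 => exact fun L => (ih1 L).trans (ih2 L)
  simpa using key []

/-- Any two sequences with the same entries are related by a sign that is common to all
alternating functions. -/
theorem perm_common {S M : Type*} [InvolutiveNeg M] [Zero M] {A B : List S} (hAB : A.Perm B) :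
    (∀ f : List S → M, AltOn f → f A = f B) ∨ (∀ f : List S → M, AltOn f → f A = -f B) := by
  have key : ∀ L : List S, (∀ f : List S → M, AltOn f → f (L ++ A) = f (L ++ B)) ∨
      (∀ f : List S → M, AltOn f → f (L ++ A) = -f (L ++ B)) := by
    induction hAB with
    | nil => exact fun L => Or.inl fun f hf => rfl
    | cons x _ ih =>
      intro L
      simpa using ih (L ++ [x])
    | swap x y l => exact fun L => Or.inr fun f hf => hf.swap L y x l
    | trans _ _ ih1 ih2 =>
      intro L
      rcases ih1 L with h1 | h1 <;> rcases ih2 L with h2 | h2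
      · exact Or.inl fun f hf => (h1 f hf).trans (h2 f hf)
      · exact Or.inr fun f hf => (h1 f hf).trans (h2 f hf)
      · exact Or.inr fun f hf => (h1 f hf).trans (by rw [h2 f hf])
      · exact Or.inl fun f hf => (h1 f hf).trans (by rw [h2 f hf, neg_neg])
  simpa using key []

theorem eq_or_neg_of_perm {S M : Type*} [InvolutiveNeg M] [Zero M] {f : List S → M} (hf : AltOn f)
    {A B : List S} (hAB : A.Perm B) : f A = f B ∨ f A = -f B :=
  (perm_common hAB).imp (fun h => h f hf) (fun h => h f hf)

theorem cons_append {S M : Type*} [AddCommGroup M] {f : List S → M} (hf : AltOn f)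
    (A : List S) (a : S) : f (A ++ [a]) = (-1 : ℤ) ^ A.length • f (a :: A) := by
  have key : ∀ (A L : List S), f (L ++ A ++ [a]) = (-1 : ℤ) ^ A.length • f (L ++ a :: A) := by
    intro A
    induction A with
    | nil => intro L; simp
    | cons b A ih =>
      intro L
      have := ih (L ++ [b])
      simp only [List.append_assoc, List.cons_append, List.nil_append] at this ⊢
      rw [this, hf.swap L b a A, List.length_cons, pow_succ]
      simp
  simpa using key A []

end AltOn

theorem IsAlternatingSign.altOn {S : Type*} {f : List S → SignType}
    (h : IsAlternatingSign f) : AltOn f where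
  swap := h.swap
  zero A hA := by
    by_contra hne
    exact hA (h.nodup hne)

theorem IsAlternatingSign.altOn_cast {S : Type*} {f : List S → SignType}
    (h : IsAlternatingSign f) (K : Type*) [Field K] : AltOn (fun A => (f A : K)) where
  swap A a b B := by simp [h.swap A a b B]
  zero A hA := by simp [h.altOn.zero A hA]

/-! ### Coordinates -/

section Coordinates

variable {K : Type*} [Field K] {S T : Type*}

theorem coord_ofFn_ιMulti {n : ℕ} (x : Fin n → S) (v : Fin n → S → K) :
    coord (List.ofFn x) (ExteriorAlgebra.ιMulti K n v) = (Matrix.of fun i j => v i (x j)).det := by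
  -- `coord L` lives in degree `L.length`; with `L` a variable, the equation of lengths can be
  -- eliminated by substitution.
  have key : ∀ (L : List S) (hL : L.length = n), coord L (ExteriorAlgebra.ιMulti K n v) =
      (Matrix.of fun i j => v i (L.get (Fin.cast hL.symm j))).det := by
    rintro L rfl
    rw [coord, ExteriorAlgebra.liftAlternating_apply_ιMulti, Pi.single_eq_same]
    rfl
  rw [key _ (List.length_ofFn)]
  congr 1
  ext i j
  simp

theorem coord_ιMulti_of_length_ne {n : ℕ} (L : List S) (hL : L.length ≠ n) (v : Fin n → S → K) :
    coord L (ExteriorAlgebra.ιMulti K n v) = 0 := by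
  rw [coord, ExteriorAlgebra.liftAlternating_apply_ιMulti, Pi.single_eq_of_ne hL.symm]
  rfl

theorem ext_coord_linear {φ ψ : ExteriorAlgebra K (S → K) →ₗ[K] K}
    (h : ∀ n (v : Fin n → S → K),
      φ (ExteriorAlgebra.ιMulti K n v) = ψ (ExteriorAlgebra.ιMulti K n v)) : φ = ψ := by
  refine LinearMap.ext_on_range (ExteriorAlgebra.ιMulti_span K (S → K)) ?_
  rintro ⟨n, v⟩
  exact h n v

theorem coord_altOn (N : ExteriorAlgebra K (S → K)) : AltOn (fun A : List S => coord A N) where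
  swap A a b B := by
    obtain ⟨n, x, i, k, hik, h1, h2⟩ := exists_ofFn_swap A a b B
    rw [← h1, ← h2, ← LinearMap.neg_apply]
    congr 1
    refine ext_coord_linear fun m v => ?_
    rw [LinearMap.neg_apply]
    by_cases hm : n = m
    · subst hm
      rw [coord_ofFn_ιMulti, coord_ofFn_ιMulti]
      have := Matrix.det_permute' (Equiv.swap i k) (Matrix.of fun i j => v i (x j))
      rw [Equiv.Perm.sign_swap hik] at this
      exact this.trans (by simp)
    · rw [coord_ιMulti_of_length_ne _ (by simpa using hm),
        coord_ιMulti_of_length_ne _ (by simpa using hm), neg_zero]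
  zero A hA := by
    have : coord A = (0 : ExteriorAlgebra K (S → K) →ₗ[K] K) := by
      refine ext_coord_linear fun m v => ?_
      by_cases hm : A.length = m
      · subst hm
        have hA' := hA
        rw [List.nodup_iff_injective_get, Function.not_injective_iff] at hA'
        obtain ⟨i, j, hij, hne⟩ := hA'
        have h1 := coord_ofFn_ιMulti A.get v
        rw [List.ofFn_get] at h1
        rw [h1, LinearMap.zero_apply]
        refine Matrix.det_zero_of_column_eq hne fun l => ?_
        simp only [Matrix.of_apply, hij]
      · rw [coord_ιMulti_of_length_ne _ hm, LinearMap.zero_apply]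
    rw [this, LinearMap.zero_apply]

variable [DecidableEq S] [DecidableEq T]

theorem extProd_eq_ιMulti (A : List S) :
    extProd K A = ExteriorAlgebra.ιMulti K A.length (fun i => Pi.single (A.get i) 1) := by
  rw [ExteriorAlgebra.ιMulti_apply, extProd]
  congr 1
  apply List.ext_getElem <;> simp

theorem extProd_append (A B : List S) : extProd K (A ++ B) = extProd K A * extProd K B := by
  simp [extProd]

theorem extProd_cons (a : S) (B : List S) : extProd K (a :: B) =
    ExteriorAlgebra.ι K (Pi.single a (1 : K) : S → K) * extProd K B := by
  simp [extProd]

theorem extProd_altOn : AltOn (fun A : List S => extProd K A) where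
  swap A a b B := by
    rw [extProd_append, extProd_append, extProd_cons, extProd_cons, extProd_cons, extProd_cons,
      ← mul_neg]
    congr 1
    rw [← mul_assoc, ← mul_assoc, ← neg_mul]
    congr 1
    exact eq_neg_of_add_eq_zero_left (ExteriorAlgebra.ι_add_mul_swap _ _)
  zero A hA := by
    rw [extProd_eq_ιMulti]
    refine AlternatingMap.map_eq_zero_of_not_injective _ _ fun hinj => hA ?_
    rw [List.nodup_iff_injective_get]
    intro i j hij
    apply hinj
    simp only [hij]

theorem coord_extProd_self {A : List S} (hA : A.Nodup) : coord A (extProd K A) = 1 := by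
  have h1 := coord_ofFn_ιMulti A.get (fun i => Pi.single (A.get i) (1 : K))
  rw [List.ofFn_get] at h1
  rw [extProd_eq_ιMulti, h1]
  convert Matrix.det_one (n := Fin A.length) (R := K)
  ext i j
  rw [Matrix.of_apply, Matrix.one_apply, Pi.single_apply]
  congr 1
  rw [(List.nodup_iff_injective_get.1 hA).eq_iff]
  exact propext eq_comm

/-- In the essential case, `A` has distinct entries and the length of `B`, so some entry of `A` is
missing from `B`; its column in the determinant is zero. -/
theorem coord_extProd_of_not_perm {A B : List S} (hAB : ¬ A.Perm B) :
    coord A (extProd K B) = 0 := by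
  by_cases hA : A.Nodup
  swap
  · exact (coord_altOn _).zero A hA
  by_cases hlen : A.length = B.length
  swap
  · rw [extProd_eq_ιMulti, coord_ιMulti_of_length_ne _ hlen]
  have : ¬ A ⊆ B := fun h => hAB ((hA.subperm h).perm_of_length_le hlen.ge)
  simp only [List.subset_def, not_forall] at this
  obtain ⟨a, ha, haB⟩ := this
  obtain ⟨j, rfl⟩ := List.get_of_mem ha
  obtain ⟨n, hn⟩ : ∃ n, n = B.length := ⟨_, rfl⟩
  have h1 := coord_ofFn_ιMulti (fun j => A.get (Fin.cast hlen.symm j))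
    (fun i => Pi.single (B.get i) (1 : K))
  have h2 : List.ofFn (fun j => A.get (Fin.cast hlen.symm j)) = A := by
    apply List.ext_getElem <;> simp [hlen]
  rw [h2] at h1
  rw [extProd_eq_ιMulti, h1]
  refine Matrix.det_eq_zero_of_column_eq_zero (Fin.cast hlen j) fun i => ?_
  rw [Matrix.of_apply, Pi.single_apply, if_neg]
  intro h
  apply haB
  simp only [Fin.cast_cast, Fin.cast_eq_self] at h
  rw [h]
  exact List.get_mem _ _

/-- The two signs cancel, so in expansions over subsets the arbitrary order of `Finset.toList` may
be replaced by any convenient one. -/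
theorem coord_smul_extProd_perm (N : ExteriorAlgebra K (S → K)) {A B : List S}
    (hAB : A.Perm B) : coord A N • extProd K A = coord B N • extProd K B :=
  (coord_altOn N).smul_perm extProd_altOn hAB

variable [Fintype S]

/-- The span contains `1` and is stable under left multiplication by vectors, hence by the whole
algebra. -/
theorem span_extProd : Submodule.span K (Set.range (extProd K : List S → _)) = ⊤ := by
  rw [eq_top_iff]
  rintro N -
  have key : ∀ w ∈ Submodule.span K (Set.range (extProd K : List S → _)),
      N * w ∈ Submodule.span K (Set.range (extProd K : List S → _)) := by
    induction N using ExteriorAlgebra.induction with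
    | algebraMap r =>
      intro w hw
      rw [← Algebra.smul_def]
      exact Submodule.smul_mem _ _ hw
    | ι x =>
      intro w hw
      have hx : x = ∑ s, x s • (Pi.single s (1 : K) : S → K) := by
        ext t; simp [Finset.sum_apply, Pi.single_apply]
      rw [hx, map_sum, Finset.sum_mul]
      refine Submodule.sum_mem _ fun s _ => ?_
      rw [map_smul, smul_mul_assoc]
      refine Submodule.smul_mem _ _ ?_
      induction hw using Submodule.span_induction with
      | mem w hw =>
        obtain ⟨B, rfl⟩ := hw
        rw [← extProd_cons]
        exact Submodule.subset_span ⟨_, rfl⟩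
      | zero => rw [mul_zero]; exact Submodule.zero_mem _
      | add u v _ _ hu hv => rw [mul_add]; exact Submodule.add_mem _ hu hv
      | smul c u _ hu => rw [mul_smul_comm]; exact Submodule.smul_mem _ _ hu
    | mul a b ha hb => intro w hw; rw [mul_assoc]; exact ha _ (hb _ hw)
    | add a b ha hb => intro w hw; rw [add_mul]; exact Submodule.add_mem _ (ha _ hw) (hb _ hw)
  rw [← mul_one N]
  exact key 1 (Submodule.subset_span ⟨[], by simp [extProd]⟩)

theorem eq_sum_coord (N : ExteriorAlgebra K (S → K)) :
    N = ∑ U : Finset S, coord U.toList N • extProd K U.toList := by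
  have hN : N ∈ Submodule.span K (Set.range (extProd K : List S → _)) := by
    rw [span_extProd]; trivial
  induction hN using Submodule.span_induction with
  | mem w hw =>
    obtain ⟨B, rfl⟩ := hw
    by_cases hB : B.Nodup
    · have hperm : B.toFinset.toList.Perm B := by
        rw [List.perm_ext_iff_of_nodup (Finset.nodup_toList _) hB]; simp
      rw [Finset.sum_eq_single B.toFinset]
      · rw [coord_smul_extProd_perm _ hperm, coord_extProd_self hB, one_smul]
      · intro U _ hU
        rw [coord_extProd_of_not_perm, zero_smul]
        intro h
        apply hU
        ext x
        rw [List.mem_toFinset, ← h.mem_iff, Finset.mem_toList]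
      · simp
    · have : extProd K B = 0 := extProd_altOn.zero B hB
      simp [this]
  | zero => simp
  | add u v _ _ hu hv =>
    nth_rw 1 [hu, hv]
    simp only [map_add, add_smul, Finset.sum_add_distrib]
  | smul c u _ hu =>
    nth_rw 1 [hu]
    simp only [map_smul, smul_assoc, Finset.smul_sum]

theorem eq_of_coord_eq {N N' : ExteriorAlgebra K (S → K)}
    (h : ∀ A : List S, coord A N = coord A N') : N = N' := by
  rw [eq_sum_coord N, eq_sum_coord N']
  simp only [h]

end Coordinates

/-! ### Extensors and their minors -/

section Extensors

variable {K : Type*} [Field K] {S T : Type*}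

theorem IsExtensor.map (f : (S → K) →ₗ[K] (T → K)) {N : ExteriorAlgebra K (S → K)}
    (h : IsExtensor N) : IsExtensor (ExteriorAlgebra.map f N) := by
  obtain ⟨α, k, v, rfl⟩ := h
  exact ⟨α, k, f ∘ v, by rw [_root_.map_smul, ExteriorAlgebra.map_apply_ιMulti]⟩

/-- Restricting vectors along `j` realizes deletion by a linear map, so deletion preserves
decomposability. -/
theorem coord_map_funLeft (j : T → S) (N : ExteriorAlgebra K (S → K)) (A : List T) :
    coord A (ExteriorAlgebra.map (LinearMap.funLeft K K j) N) = coord (A.map j) N := by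
  have : (coord A).comp (ExteriorAlgebra.map (LinearMap.funLeft K K j)).toLinearMap =
      (coord (A.map j) : ExteriorAlgebra K (S → K) →ₗ[K] K) := by
    refine ext_coord_linear fun n v => ?_
    rw [LinearMap.comp_apply, AlgHom.toLinearMap_apply, ExteriorAlgebra.map_apply_ιMulti]
    by_cases hn : A.length = n
    · subst hn
      have h1 := coord_ofFn_ιMulti A.get (LinearMap.funLeft K K j ∘ v)
      have h2 := coord_ofFn_ιMulti (j ∘ A.get) v
      rw [← List.map_ofFn, List.ofFn_get] at h2
      rw [List.ofFn_get] at h1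
      rw [h1, h2]
      rfl
    · rw [coord_ιMulti_of_length_ne _ hn, coord_ιMulti_of_length_ne _ (by simpa using hn)]
  rw [← this]
  rfl

theorem isExtensor_zero : IsExtensor (0 : ExteriorAlgebra K (S → K)) :=
  ⟨0, 0, fun _ => 0, by rw [zero_smul]⟩

/-- The contraction of an extensor by a single element is an extensor. -/
theorem IsExtensor.exists_contract {N : ExteriorAlgebra K (S → K)} (h : IsExtensor N) (a : S) :
    ∃ N' : ExteriorAlgebra K (S → K), IsExtensor N' ∧
      ∀ A, coord (A ++ [a]) N = coord A N' := by
  obtain ⟨α, k, v, rfl⟩ := h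
  by_cases hv : ∃ i, v i a ≠ 0
  swap
  · push Not at hv
    refine ⟨0, isExtensor_zero, fun A => ?_⟩
    rw [map_smul, map_zero]
    by_cases hk : (A ++ [a]).length = k
    · subst hk
      have h1 := coord_ofFn_ιMulti (A ++ [a]).get v
      rw [List.ofFn_get] at h1
      rw [h1, Matrix.det_eq_zero_of_column_eq_zero ⟨A.length, by simp⟩, smul_zero]
      intro i
      rw [Matrix.of_apply]
      simpa using hv i
    · rw [coord_ιMulti_of_length_ne _ hk, smul_zero]
  obtain ⟨i₀, hi₀⟩ := hv
  obtain ⟨n, rfl⟩ : ∃ n, k = n + 1 := ⟨k - 1, by have := i₀.pos; omega⟩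
  -- Row `i₀` is the pivot that clears column `a`; the remaining rows span the contraction. The sign
  -- `(-1) ^ n` moves `a` to the front, and `(-1) ^ i₀ * v i₀ a` comes from the Laplace expansion
  -- along the first column.
  refine ⟨_, ⟨(-1) ^ n * (α * ((-1) ^ (i₀ : ℕ) * v i₀ a)), n,
    fun i s => v (i₀.succAbove i) s - v (i₀.succAbove i) a / v i₀ a * v i₀ s, rfl⟩, fun A => ?_⟩
  rw [(coord_altOn _).cons_append, map_smul, map_smul]
  by_cases hA : A.length = n
  swap
  · rw [coord_ιMulti_of_length_ne _ hA, coord_ιMulti_of_length_ne _ (by simpa using hA)]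
    simp
  subst hA
  let x : Fin (A.length + 1) → S := Fin.cons a A.get
  have h1 := coord_ofFn_ιMulti x v
  have h2 := coord_ofFn_ιMulti A.get
    (fun i s => v (i₀.succAbove i) s - v (i₀.succAbove i) a / v i₀ a * v i₀ s)
  rw [List.ofFn_get] at h2
  simp only [x, List.ofFn_cons, List.ofFn_get] at h1
  rw [h1, h2]
  -- The multipliers of the row operations, zero at `i₀` so that the pivot row stays unchanged.
  let c : Fin (A.length + 1) → K := fun i => if i = i₀ then 0 else v i a / v i₀ a
  rw [Matrix.det_eq_of_forall_row_eq_smul_add_const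
    (B := Matrix.of fun i j => v i (x j) - c i * v i₀ (x j))
    c i₀ (by simp [c]) (by intro i j; simp [c, x]), Matrix.det_succ_column_zero,
    Finset.sum_eq_single i₀]
  · have : (Matrix.of fun i j => v i (x j) -
        c i * v i₀ (x j)).submatrix i₀.succAbove Fin.succ =
        Matrix.of fun i j => v (i₀.succAbove i) (A.get j) -
          v (i₀.succAbove i) a / v i₀ a * v i₀ (A.get j) := by
      ext i j
      simp [c, x, Fin.succAbove_ne]
    rw [this]
    simp [c, x]
    ring
  · intro i _ hi
    simp [c, x, hi, hi₀]
  · simp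

/-- The minors of an extensor are extensors. -/
theorem IsExtensor.exists_minor {N : ExteriorAlgebra K (S → K)} (h : IsExtensor N) (j : T → S)
    (Z : List S) :
    ∃ N' : ExteriorAlgebra K (T → K), IsExtensor N' ∧
      ∀ A, coord (A.map j ++ Z) N = coord A N' := by
  -- The entries of `Z` are contracted one at a time, the last one first; restriction along `j` then
  -- deletes the rest.
  have key : ∃ N' : ExteriorAlgebra K (S → K), IsExtensor N' ∧
      ∀ A, coord (A ++ Z) N = coord A N' := by
    induction Z with
    | nil => exact ⟨N, h, by simp⟩
    | cons z Z ih =>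
      obtain ⟨N', h', hN'⟩ := ih
      obtain ⟨N'', h'', hN''⟩ := h'.exists_contract z
      refine ⟨N'', h'', fun A => ?_⟩
      rw [← hN'', ← hN', List.append_assoc, List.singleton_append]
  obtain ⟨N', h', hN'⟩ := key
  exact ⟨_, h'.map (LinearMap.funLeft K K j), fun A => by rw [hN', coord_map_funLeft]⟩

/-- An extensor over `ℚ` may be regarded as one over a field of characteristic zero. -/
theorem IsExtensor.exists_cast (K : Type*) [Field K] [CharZero K] {N : ExteriorAlgebra ℚ (S → ℚ)}
    (h : IsExtensor N) :
    ∃ N' : ExteriorAlgebra K (S → K), IsExtensor N' ∧ ∀ A, coord A N' = ((coord A N : ℚ) : K) := by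
  obtain ⟨α, k, v, rfl⟩ := h
  refine ⟨_, ⟨α, k, fun i s => (v i s : K), rfl⟩, fun A => ?_⟩
  rw [map_smul, map_smul]
  by_cases hA : A.length = k
  · subst hA
    have h1 := coord_ofFn_ιMulti A.get (fun i s => (v i s : K))
    have h2 := coord_ofFn_ιMulti A.get v
    rw [List.ofFn_get] at h1 h2
    rw [h1, h2, smul_eq_mul, smul_eq_mul, Rat.cast_mul]
    congr 1
    exact ((Rat.castHom K).map_det _).symm
  · rw [coord_ιMulti_of_length_ne _ hA, coord_ιMulti_of_length_ne _ hA]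
    simp

theorem OrientedMatroid.IsUnimodular.exists_presentation (K : Type*) [Field K] [CharZero K]
    {𝒩 : OrientedMatroid S} (h : 𝒩.IsUnimodular) :
    ∃ N : ExteriorAlgebra K (S → K), IsUnimodularPresentation N 𝒩 := by
  obtain ⟨N, hN, χ, hχ, hc⟩ := h
  obtain ⟨N', hN', hc'⟩ := hN.exists_cast K
  refine ⟨N', hN', χ, hχ, fun A => ?_⟩
  rw [hc', hc]
  cases χ.toFun A <;> simp

theorem IsUnimodularPresentation.eq_or_eq_neg [Finite S] {N N' : ExteriorAlgebra K (S → K)}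
    {𝒩 : OrientedMatroid S} (h : IsUnimodularPresentation N 𝒩)
    (h' : IsUnimodularPresentation N' 𝒩) : N = N' ∨ N = -N' := by
  classical
  have := Fintype.ofFinite S
  obtain ⟨-, χ, hχ, hc⟩ := h
  obtain ⟨-, χ', hχ', hc'⟩ := h'
  rcases Quotient.exact (hχ.trans hχ'.symm) with rfl | rfl
  · exact Or.inl (eq_of_coord_eq fun A => by rw [hc, hc'])
  · refine Or.inr (eq_of_coord_eq fun A => ?_)
    rw [hc, map_neg, hc', ← SignType.coe_neg]
    rfl

variable [DecidableEq T]

/-- Every alternating function is thus the coordinate function of some element, which makes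
`extMinor` independent of the listing of subsets. -/
theorem coord_sum_altOn [Fintype T] {φ : List T → K} (hφ : AltOn φ) (X : List T) :
    coord X (∑ U : Finset T, φ U.toList • (extProd K U.toList : ExteriorAlgebra K (T → K))) =
      φ X := by
  by_cases hX : X.Nodup
  swap
  · rw [(coord_altOn _).zero X hX, hφ.zero X hX]
  rw [map_sum, Finset.sum_eq_single X.toFinset]
  · have hperm : X.toFinset.toList.Perm X := by
      rw [List.perm_ext_iff_of_nodup (Finset.nodup_toList _) hX]; simp
    rw [hφ.smul_perm (extProd_altOn (K := K)) hperm, map_smul, coord_extProd_self hX,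
      smul_eq_mul, mul_one]
  · intro U _ hU
    rw [map_smul, coord_extProd_of_not_perm, smul_zero]
    intro h
    apply hU
    ext x
    rw [List.mem_toFinset, h.mem_iff, Finset.mem_toList]
  · simp

theorem coord_extMinor [Fintype T] (j : T → S) (Z : List S) (N : ExteriorAlgebra K (S → K))
    (X : List T) : coord X (extMinor j Z N) = coord (X.map j ++ Z) N :=
  coord_sum_altOn (φ := fun X => coord (X.map j ++ Z) N)
    (by simpa using (coord_altOn N).context [] j Z) X

theorem IsExtensor.extMinor [Fintype T] {N : ExteriorAlgebra K (S → K)} (h : IsExtensor N)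
    (j : T → S) (Z : List S) : IsExtensor (extMinor j Z N) := by
  obtain ⟨N', h', hN'⟩ := h.exists_minor j Z
  convert h'
  refine eq_of_coord_eq fun A => ?_
  rw [coord_extMinor, hN']

end Extensors

/-! ### Independence of the presentation -/

section ME

variable {K : Type*} [Field K] {P E : Type*} [Fintype P] [Fintype E] [DecidableEq P]
  [DecidableEq E]

/-- `N` enters twice, once directly and once through its linear dual, so the signs cancel. -/
theorem extME_neg (ε : GroundSetOrientation (P ⊕ E)) (g r : E → K) (e : List E)
    (N : ExteriorAlgebra K (P ⊕ E → K)) : extME ε g r e (-N) = extME ε g r e N := by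
  have : dual ε (-N) = -dual ε N := by
    simp [dual, Finset.sum_neg_distrib]
  rw [extME, extM, this, map_neg, map_neg, neg_mul_neg]
  rfl

theorem IsUnimodularPresentation.extME_eq (ε : GroundSetOrientation (P ⊕ E)) (g r : E → K)
    (e : List E) {𝒩 : OrientedMatroid (P ⊕ E)} {N : ExteriorAlgebra K (P ⊕ E → K)}
    (h : IsUnimodularPresentation N 𝒩) : extME ε g r e N = 𝒩.ME ε g r e := by
  have hex : ∃ N : ExteriorAlgebra K (P ⊕ E → K), IsUnimodularPresentation N 𝒩 := ⟨N, h⟩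
  rw [OrientedMatroid.ME, dif_pos hex]
  rcases h.eq_or_eq_neg hex.choose_spec with h1 | h1
  · rw [← h1]
  · rw [h1, extME_neg]

end ME

/-! ### Expansion of `M_E` -/

section Expansion

variable {K : Type*} [Field K] {P E : Type*}

/-- The sequence that lists the elements of `X ⊔ A`, for `X ⊆ P` and `A ⊆ E`. -/
noncomputable def sumList (X : Finset P) (A : Finset E) : List (P ⊕ E) :=
  X.toList.map Sum.inl ++ A.toList.map Sum.inr

theorem mem_sumList_inl {X : Finset P} {A : Finset E} {x : P} :
    Sum.inl x ∈ sumList X A ↔ x ∈ X := by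
  simp [sumList]

theorem mem_sumList_inr {X : Finset P} {A : Finset E} {x : E} :
    Sum.inr x ∈ sumList X A ↔ x ∈ A := by
  simp [sumList]

theorem sumList_nodup (X : Finset P) (A : Finset E) : (sumList X A).Nodup := by
  rw [sumList, List.nodup_append']
  refine ⟨(Finset.nodup_toList _).map Sum.inl_injective,
    (Finset.nodup_toList _).map Sum.inr_injective, ?_⟩
  intro x hx hx'
  simp only [List.mem_map] at hx hx'
  obtain ⟨a, -, rfl⟩ := hx
  obtain ⟨b, -, h⟩ := hx'
  cases h

theorem toList_perm_sumList (U : Finset (P ⊕ E)) :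
    U.toList.Perm (sumList U.toLeft U.toRight) := by
  rw [List.perm_ext_iff_of_nodup (Finset.nodup_toList _) (sumList_nodup _ _)]
  rintro (x | x)
  · simp [mem_sumList_inl]
  · simp [mem_sumList_inr]

theorem toList_perm_of_nodup {S : Type*} [DecidableEq S] [Fintype S] (Y : Finset S)
    {p : List S} (hp : p.Nodup) (hp' : ∀ x, x ∈ p) : (Yᶜ.toList ++ Y.toList).Perm p := by
  rw [List.perm_ext_iff_of_nodup _ hp]
  · intro x
    simpa [hp'] using (em (x ∈ Y)).symm
  · rw [List.nodup_append']
    refine ⟨Finset.nodup_toList _, Finset.nodup_toList _, ?_⟩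
    intro x hx hx'
    simp at hx hx'
    exact hx hx'

variable [Fintype P] [Fintype E] [DecidableEq P] [DecidableEq E]

omit [DecidableEq P] [DecidableEq E] in
theorem sum_finset_sum {M : Type*} [AddCommMonoid M] (F : Finset (P ⊕ E) → M)
    (G : Finset P → Finset E → M) (h : ∀ U, F U = G U.toLeft U.toRight) :
    ∑ U, F U = ∑ A, ∑ X, G X A := by
  rw [← Fintype.sum_prod_type_right' (f := G)]
  exact Fintype.sum_equiv Finset.sumEquiv.toEquiv _ _ h

theorem eq_sum_sumList (N : ExteriorAlgebra K (P ⊕ E → K)) :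
    N = ∑ A, ∑ X, coord (sumList X A) N • extProd K (sumList X A) := by
  nth_rw 1 [eq_sum_coord N]
  exact sum_finset_sum _ (fun X A => coord (sumList X A) N • extProd K (sumList X A))
    fun U => coord_smul_extProd_perm N (toList_perm_sumList U)

theorem dual_eq_sum_sumList (ε : GroundSetOrientation (P ⊕ E))
    (N : ExteriorAlgebra K (P ⊕ E → K)) :
    dual ε N = ∑ B, ∑ Y, (coord (sumList Yᶜ Bᶜ) N *
      (ε.toFun (sumList Yᶜ Bᶜ ++ sumList Y B) : K)) • extProd K (sumList Y B) := by
  refine sum_finset_sum _ (fun Y B => (coord (sumList Yᶜ Bᶜ) N *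
      (ε.toFun (sumList Yᶜ Bᶜ ++ sumList Y B) : K)) • extProd K (sumList Y B)) fun U => ?_
  have hε := ε.alternating.altOn_cast K
  have h1 : Uᶜ.toList.Perm (sumList U.toLeftᶜ U.toRightᶜ) := by
    convert toList_perm_sumList Uᶜ using 2 <;> ext <;> simp
  -- The complement of `U` occurs in `N` and `ε`, and `U` in `ε` and `extProd`; each set sits in two
  -- alternating factors and can be relisted separately.
  have h2 := (coord_altOn N).smul_perm (hε.context [] id U.toList) h1
  have h3 := (hε.context (sumList U.toLeftᶜ U.toRightᶜ) id []).smul_perm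
    (extProd_altOn (K := K)) (toList_perm_sumList U)
  simp only [List.map_id, List.nil_append, smul_eq_mul, List.append_nil] at h2 h3
  rw [h2, mul_smul, h3, mul_smul]

omit [Fintype P] [Fintype E] [DecidableEq P] [DecidableEq E] in
theorem map_extProd {S T : Type*} [DecidableEq S] [DecidableEq T] (f : (S → K) →ₗ[K] (T → K))
    (c : S → K) (t : S → T) (h : ∀ s, f (Pi.single s 1) = c s • Pi.single (t s) 1) (L : List S) :
    ExteriorAlgebra.map f (extProd K L) = (L.map c).prod • extProd K (L.map t) := by
  induction L with
  | nil => simp [extProd]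
  | cons s L ih =>
    rw [extProd_cons, map_mul, ih, ExteriorAlgebra.map_apply_ι, h, map_smul, List.map_cons,
      List.map_cons, List.prod_cons, extProd_cons, smul_mul_smul_comm]

theorem map_iotaMap_extProd (g : E → K) (X : Finset P) (A : Finset E) :
    ExteriorAlgebra.map (iotaMap g) (extProd K (sumList X A)) =
      (∏ a ∈ A, g a) • extProd K (X.toList.map (Sum.inl ∘ Sum.inl) ++ A.toList.map Sum.inr) := by
  rw [map_extProd (iotaMap g) (Sum.elim 1 g) (Sum.map Sum.inl id)]
  · simp [sumList, Function.comp_def]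
  · intro s
    rw [iotaMap, ← Pi.basisFun_apply, Module.Basis.constr_basis]
    cases s <;> simp

theorem map_upsilonMap_extProd (r : E → K) (X : Finset P) (A : Finset E) :
    ExteriorAlgebra.map (upsilonMap r) (extProd K (sumList X A)) =
      (∏ a ∈ A, r a) • extProd K (X.toList.map (Sum.inl ∘ Sum.inr) ++ A.toList.map Sum.inr) := by
  rw [map_extProd (upsilonMap r) (Sum.elim 1 r) (Sum.map Sum.inr id)]
  · simp [sumList, Function.comp_def]
  · intro s
    rw [upsilonMap, ← Pi.basisFun_apply, Module.Basis.constr_basis]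
    cases s <;> simp

/-- `extMinor` as a linear map. -/
noncomputable def extMinorLinear {S T : Type*} [DecidableEq T] [Fintype T] (j : T → S)
    (Z : List S) : ExteriorAlgebra K (S → K) →ₗ[K] ExteriorAlgebra K (T → K) where
  toFun := extMinor j Z
  map_add' x y := eq_of_coord_eq fun A => by simp only [coord_extMinor, map_add]
  map_smul' c x := eq_of_coord_eq fun A => by
    simp only [coord_extMinor, map_smul, RingHom.id_apply]

theorem extMinor_extProd {S T : Type*} [DecidableEq S] [DecidableEq T] [Fintype T] {j : T → S}
    (hj : Function.Injective j) {Z : List S} {U : List T} (hU : (U.map j ++ Z).Nodup) :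
    extMinor j Z (extProd K (U.map j ++ Z)) = extProd K U := by
  refine eq_of_coord_eq fun A => ?_
  rw [coord_extMinor]
  have hU' : U.Nodup := (List.nodup_append'.1 hU).1.of_map
  by_cases hA : A.Perm U
  · have h1 := (coord_altOn (extProd K (U.map j ++ Z))).context [] j Z
    simp only [List.nil_append] at h1
    have h2 := coord_altOn (extProd K U)
    have h3 : coord (U.map j ++ Z) (extProd K (U.map j ++ Z)) = coord U (extProd K U) := by
      rw [coord_extProd_self hU, coord_extProd_self hU']
    -- Passing from `A` to `U` costs the same sign on both sides.
    rcases AltOn.perm_common (M := K) hA with h | h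
    · rw [h _ h1, h _ h2, h3]
    · rw [h _ h1, h _ h2, h3]
  · rw [coord_extProd_of_not_perm hA, coord_extProd_of_not_perm]
    rwa [List.perm_append_right_iff, List.map_perm_map_iff hj]

/-- The coordinates are read at sequences that contain all of `E`, and a non-zero monomial has no
repetition; so `A` and `B` would have to partition `E`. -/
theorem extMinor_extProd_eq_zero {e : List E} (he' : ∀ x, x ∈ e) (U V : List P)
    {A B : Finset E} (hB : B ≠ Aᶜ) :
    extMinor Sum.inl (e.map Sum.inr) (extProd K
      ((U.map (Sum.inl ∘ Sum.inl) ++ A.toList.map Sum.inr) ++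
        (V.map (Sum.inl ∘ Sum.inr) ++ B.toList.map Sum.inr)) :
        ExteriorAlgebra K ((P ⊕ P) ⊕ E → K)) = 0 := by
  refine eq_of_coord_eq fun Z => ?_
  rw [coord_extMinor, map_zero]
  set W : List ((P ⊕ P) ⊕ E) := (U.map (Sum.inl ∘ Sum.inl) ++ A.toList.map Sum.inr) ++
        (V.map (Sum.inl ∘ Sum.inr) ++ B.toList.map Sum.inr) with hW
  by_cases hn : W.Nodup
  · apply coord_extProd_of_not_perm
    intro h
    apply hB
    ext x
    have h1 : Sum.inr x ∈ W := by
      rw [← h.mem_iff]; simp [he']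
    have hd := (List.nodup_append'.1 hn).2.2
    have h2 := @hd (Sum.inr x)
    simp [hW] at h1 h2
    rw [Finset.mem_compl]
    tauto
  · rw [extProd_altOn.zero W hn, map_zero]

/-- The coordinates of `M_E(N)`. -/
theorem extME_eq_sum (ε : GroundSetOrientation (P ⊕ E)) (g r : E → K) (e : List E)
    (he : e.Nodup) (he' : ∀ x, x ∈ e) (N : ExteriorAlgebra K (P ⊕ E → K)) :
    extME ε g r e N = ∑ A : Finset E, ∑ X : Finset P, ∑ Y : Finset P,
      (((∏ a ∈ A, g a) * ∏ a ∈ Aᶜ, r a) * (coord (sumList X A) N * coord (sumList Yᶜ A) N) *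
        (ε.toFun ((Yᶜ.toList ++ Y.toList).map Sum.inl ++ e.map Sum.inr) : K)) •
      extProd K (X.toList.map Sum.inl ++ Y.toList.map Sum.inr) := by
  have h0 : extM ε g r N = ∑ A : Finset E, ∑ X : Finset P, ∑ B : Finset E, ∑ Y : Finset P,
      (coord (sumList X A) N * (∏ a ∈ A, g a) * ((coord (sumList Yᶜ Bᶜ) N *
        (ε.toFun (sumList Yᶜ Bᶜ ++ sumList Y B) : K)) * ∏ a ∈ B, r a)) •
      extProd K ((X.toList.map (Sum.inl ∘ Sum.inl) ++ A.toList.map Sum.inr) ++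
        (Y.toList.map (Sum.inl ∘ Sum.inr) ++ B.toList.map Sum.inr)) := by
    rw [extM, dual_eq_sum_sumList]
    nth_rw 1 [eq_sum_sumList N]
    simp only [map_sum, map_smul, map_iotaMap_extProd, map_upsilonMap_extProd, Finset.sum_mul]
    simp only [Finset.mul_sum, smul_mul_smul_comm, smul_smul, ← extProd_append]
  change extMinorLinear Sum.inl (e.map Sum.inr) _ = _
  rw [h0]
  simp only [map_sum, map_smul]
  refine Finset.sum_congr rfl fun A _ => Finset.sum_congr rfl fun X _ => ?_
  rw [Finset.sum_eq_single Aᶜ]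
  rotate_left
  · intro B _ hB
    refine Finset.sum_eq_zero fun Y _ => ?_
    have := extMinor_extProd_eq_zero (K := K) he' X.toList Y.toList hB
    change _ • extMinor Sum.inl (e.map Sum.inr) _ = _
    rw [this, smul_zero]
  · simp
  refine Finset.sum_congr rfl fun Y _ => ?_
  rw [compl_compl]
  have hε := ε.alternating.altOn_cast K
  -- Rearranging `A Y Ā` into `Y E` changes `ε(Ȳ ·)` and the monomial `X ·` by the same sign, so
  -- `ε(ȲAYĀ) XAYĀ = ε(ȲYE) XYE`.
  have h1 := (hε.context (Yᶜ.toList.map Sum.inl) id []).smul_perm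
    (A := (A.toList.map Sum.inr ++ sumList Y Aᶜ)) (B := Y.toList.map Sum.inl ++ e.map Sum.inr)
    (((extProd_altOn (K := K)).context (X.toList.map (Sum.inl ∘ Sum.inl))
      (Sum.map Sum.inr id : P ⊕ E → (P ⊕ P) ⊕ E) []).map_linear
        (extMinorLinear Sum.inl (e.map Sum.inr))) (by
      rw [sumList]
      refine (List.perm_append_comm_assoc _ _ _).trans (List.Perm.append_left _ ?_)
      rw [← List.map_append]
      refine List.Perm.map _ ?_
      have := toList_perm_of_nodup Aᶜ he he'
      rwa [compl_compl] at this)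
  have h2 := extMinor_extProd (K := K) (j := (Sum.inl : P ⊕ P → (P ⊕ P) ⊕ E)) Sum.inl_injective
    (Z := e.map Sum.inr) (U := X.toList.map Sum.inl ++ Y.toList.map Sum.inr) (by
      have hXY : (X.toList.map Sum.inl ++ Y.toList.map Sum.inr).Nodup := sumList_nodup X Y
      rw [List.nodup_append']
      refine ⟨hXY.map Sum.inl_injective, he.map Sum.inr_injective, ?_⟩
      simp [List.Disjoint])
  change extMinorLinear Sum.inl (e.map Sum.inr) _ = _ at h2
  have hl : (Sum.map Sum.inr id : P ⊕ E → (P ⊕ P) ⊕ E) ∘ Sum.inl = Sum.inl ∘ Sum.inr := rfl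
  have hr : (Sum.map Sum.inr id : P ⊕ E → (P ⊕ P) ⊕ E) ∘ Sum.inr = Sum.inr := rfl
  simp only [List.append_nil, List.map_append, List.map_map, sumList, hl, hr,
    Function.id_comp, List.append_assoc] at h1 h2 ⊢
  rw [h2] at h1
  rw [mul_smul _ (_ : K) (extProd K _), ← h1, smul_smul]
  congr 1
  ring

/-- For fixed `A`, both coordinates of `N` in `extME_eq_sum` are coordinates of `N/A|P`; only the
sign has to be compared. -/
theorem extME_eq_sum_minors (ε : GroundSetOrientation (P ⊕ E)) (g r : E → K)
    (p : List P) (hp : p.Nodup) (hp' : ∀ x, x ∈ p)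
    (e : List E) (he : e.Nodup) (he' : ∀ x, x ∈ e) (N : ExteriorAlgebra K (P ⊕ E → K)) :
    extME ε g r e N = ∑ A : Finset E, ((∏ a ∈ A, g a) * ∏ a ∈ Aᶜ, r a) • (portSign ε p e : K) •
      extME (ε.comap (portIncl P E) (portIncl_injective P E)) Empty.elim Empty.elim []
        (extMinor (portIncl P E) (A.toList.map Sum.inr) N) := by
  rw [extME_eq_sum ε g r e he he']
  refine Finset.sum_congr rfl fun A _ => ?_
  -- `M_∅` is expanded by the same formula, whose sum over subsets of `Empty` has the single term
  -- `∅`.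
  rw [extME_eq_sum _ _ _ [] List.nodup_nil (fun x => x.elim),
    Fintype.sum_eq_single (α := Finset Empty) ∅
    (fun B hB => (hB (Finset.eq_empty_of_isEmpty B)).elim)]
  simp only [Finset.smul_sum, smul_smul]
  refine Finset.sum_congr rfl fun X _ => Finset.sum_congr rfl fun Y _ => ?_
  congr 1
  have h1 : ∀ X : Finset P, coord (sumList X ∅)
      (extMinor (portIncl P E) (A.toList.map Sum.inr) N) = coord (sumList X A) N := by
    intro X
    rw [coord_extMinor]
    simp [sumList, portIncl, Function.comp_def]
  have h2 : (ε.comap (portIncl P E) (portIncl_injective P E)).toFun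
      ((Yᶜ.toList ++ Y.toList).map Sum.inl ++ [].map Sum.inr) =
        ε.toFun ((Yᶜ.toList ++ Y.toList).map Sum.inl) := by
    simp [GroundSetOrientation.comap, portIncl, Function.comp_def]
  -- Both factors are alternating in `ȲY`, so their product has the same value at the listing `p` of
  -- the ports.
  have h3 : (ε.toFun ((Yᶜ.toList ++ Y.toList).map Sum.inl) : K) *
      ε.toFun ((Yᶜ.toList ++ Y.toList).map Sum.inl ++ e.map Sum.inr) = portSign ε p e := by
    have hε := ε.alternating.altOn_cast K
    have := (hε.context [] Sum.inl []).smul_perm (hε.context [] Sum.inl (e.map Sum.inr))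
      (toList_perm_of_nodup Y hp hp')
    simp only [List.nil_append, List.append_nil, smul_eq_mul] at this
    rw [this, portSign, SignType.coe_mul]
  have h4 : (ε.toFun ((Yᶜ.toList ++ Y.toList).map Sum.inl) : K) *
      ε.toFun ((Yᶜ.toList ++ Y.toList).map Sum.inl) = 1 := by
    have hne := ε.ne_zero ((Yᶜ.toList ++ Y.toList).map Sum.inl)
      (((toList_perm_of_nodup Y hp hp').nodup_iff.2 hp).map Sum.inl_injective)
    rw [← SignType.coe_mul]
    generalize ε.toFun ((Yᶜ.toList ++ Y.toList).map Sum.inl) = s at hne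
    have : s * s = 1 := by revert s; decide
    rw [this, SignType.coe_one]
  rw [h1, h1, h2, ← h3]
  simp only [Finset.prod_of_isEmpty, one_mul]
  linear_combination (-(∏ a ∈ A, g a) * (∏ a ∈ Aᶜ, r a) * coord (sumList X A) N *
    coord (sumList Yᶜ A) N *
    (ε.toFun ((Yᶜ.toList ++ Y.toList).map Sum.inl ++ e.map Sum.inr) : K)) * h4

end Expansion

/-! ### Ranks and minors of oriented matroids -/

theorem List.Nodup.encard_setOf_mem {S : Type*} {A : List S} (hA : A.Nodup) :
    {x | x ∈ A}.encard = A.length := by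
  classical
  have : ({x | x ∈ A} : Set S) = (A.toFinset : Set S) := by ext; simp
  rw [this, Set.encard_coe_eq_coe_finsetCard, List.toFinset_card_of_nodup hA]

namespace Chirotope

variable {S T : Type*} [Finite S] (χ : Chirotope S)

theorem isBase_of_ne_zero {A : List S} (hA : χ.toFun A ≠ 0) : χ.matroid.IsBase {x | x ∈ A} :=
  (χ.matroid_isBase A (χ.alternating.nodup hA)).2 hA

theorem rk_eq_length {B : List S} (hB : B.Nodup) {C : Set S}
    (h : χ.matroid.IsBasis {x | x ∈ B} C) : (OrientedMatroid.ofChirotope χ).rk C = B.length := by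
  change (χ.matroid.eRk C).toNat = _
  rw [← h.encard_eq_eRk, hB.encard_setOf_mem]
  rfl

theorem rank_eq_length {A : List S} (hA : χ.toFun A ≠ 0) :
    (OrientedMatroid.ofChirotope χ).rank = A.length :=
  χ.rk_eq_length (χ.alternating.nodup hA) (χ.isBase_of_ne_zero hA).isBasis_ground

theorem exists_minor_eq (j : T → S) (C : Set S) : ∃ Z, IsMinorSequence χ.matroid j C Z ∧
    ∀ X, (χ.minor j C).toFun X = χ.toFun (X.map j ++ Z) :=
  ⟨_, Classical.choose_spec (exists_isMinorSequence χ.matroid rfl j C), fun _ => rfl⟩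

omit [Finite S] in
theorem ofChirotope_neg (χ : Chirotope S) :
    OrientedMatroid.ofChirotope χ.neg = OrientedMatroid.ofChirotope χ :=
  Quotient.sound (Or.inr rfl)

end Chirotope

/-! ### Port minors and the vanishing of the exponents -/

section PortMinor

variable {P E : Type*} [Fintype P] [Fintype E]

/-- With `Z = DB` as in `IsMinorSequence`, `ρ𝒩 = |X| + |D| + |B|` and `ρA = |B|`. The exponents are
therefore `|D|` and `|A| - |B|`; when they vanish, `Z` is a listing of `A`. -/
theorem Chirotope.exists_portMinor_eq (χ : Chirotope (P ⊕ E)) (A : Finset E)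
    (h1 : (OrientedMatroid.ofChirotope χ).rank -
      ((OrientedMatroid.ofChirotope χ).portMinor A).rank -
      (OrientedMatroid.ofChirotope χ).rk (Sum.inr '' (A : Set E)) = 0)
    (h2 : A.card - (OrientedMatroid.ofChirotope χ).rk (Sum.inr '' (A : Set E)) = 0) :
    ∃ χ', OrientedMatroid.ofChirotope χ' = (OrientedMatroid.ofChirotope χ).portMinor A ∧
      ∀ X, χ'.toFun X = χ.toFun (X.map (portIncl P E) ++ A.toList.map Sum.inr) := by
  obtain ⟨Z, ⟨X, D, B, rfl, hn, hB, -, hX⟩, hm⟩ :=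
    χ.exists_minor_eq (portIncl P E) (Sum.inr '' (A : Set E))
  have hne := (χ.matroid_isBase _ hn).1 hX
  have hBn : B.Nodup := (List.nodup_append'.1 (List.nodup_append'.1 hn).2.1).2.1
  have hr := χ.rank_eq_length hne
  have hr' : ((OrientedMatroid.ofChirotope χ).portMinor A).rank = X.length :=
    (χ.minor (portIncl P E) (Sum.inr '' (A : Set E))).rank_eq_length (by rwa [hm])
  rw [hr, hr', χ.rk_eq_length hBn hB] at h1
  rw [χ.rk_eq_length hBn hB] at h2
  simp only [List.length_append, List.length_map] at h1
  obtain rfl : D = [] := List.length_eq_zero_iff.1 (by omega)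
  have hperm : B.Perm (A.toList.map Sum.inr) := by
    refine (hBn.subperm fun x hx => ?_).perm_of_length_le ?_
    · simpa using hB.subset hx
    · rw [List.length_map, Finset.length_toList]; omega
  have halt : ∀ X : List (P ⊕ Empty),
      AltOn (fun L : List (P ⊕ E) => χ.toFun (X.map (portIncl P E) ++ L)) := by
    intro X
    simpa using χ.alternating.altOn.context (X.map (portIncl P E)) id []
  -- If the listings `B` and `A.toList` differ by an odd permutation, the opposite chirotope of the
  -- minor is taken.
  rcases AltOn.perm_common (M := SignType) hperm with h | h
  · exact ⟨_, rfl, fun X => by rw [hm]; exact h _ (halt X)⟩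
  · refine ⟨_, Chirotope.ofChirotope_neg _, fun X => ?_⟩
    change -(χ.minor _ _).toFun X = _
    rw [hm, neg_eq_iff_eq_neg]
    exact h _ (halt X)

/-- `X'A` is a base, so `A` is independent and `P ∪ A` is spanning. -/
theorem Chirotope.exponents_eq_zero (χ : Chirotope (P ⊕ E)) (A : Finset E)
    {X' : List (P ⊕ Empty)}
    (hX' : χ.toFun (X'.map (portIncl P E) ++ A.toList.map Sum.inr) ≠ 0) :
    (OrientedMatroid.ofChirotope χ).rank -
      ((OrientedMatroid.ofChirotope χ).portMinor A).rank -
      (OrientedMatroid.ofChirotope χ).rk (Sum.inr '' (A : Set E)) = 0 ∧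
    A.card - (OrientedMatroid.ofChirotope χ).rk (Sum.inr '' (A : Set E)) = 0 := by
  obtain ⟨Z, ⟨X, D, B, rfl, hn, hB, hXB, hX⟩, hm⟩ :=
    χ.exists_minor_eq (portIncl P E) (Sum.inr '' (A : Set E))
  have hne := (χ.matroid_isBase _ hn).1 hX
  have hBn : B.Nodup := (List.nodup_append'.1 (List.nodup_append'.1 hn).2.1).2.1
  have hr := χ.rank_eq_length hne
  have hr' : ((OrientedMatroid.ofChirotope χ).portMinor A).rank = X.length :=
    (χ.minor (portIncl P E) (Sum.inr '' (A : Set E))).rank_eq_length (by rwa [hm])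
  have hbase := χ.isBase_of_ne_zero hX'
  have hA : χ.matroid.IsBasis {x | x ∈ A.toList.map (Sum.inr : E → P ⊕ E)}
      (Sum.inr '' (A : Set E)) := by
    have : ({x | x ∈ A.toList.map (Sum.inr : E → P ⊕ E)}) = Sum.inr '' (A : Set E) := by
      ext x; simp
    rw [this]
    refine (hbase.indep.subset ?_).isBasis_self
    rw [← this]
    intro x hx
    exact List.mem_append_right _ hx
  have h1 := χ.rk_eq_length ((Finset.nodup_toList A).map Sum.inr_injective) hA
  have h2 := χ.rk_eq_length hBn hB
  rw [List.length_map, Finset.length_toList] at h1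
  have hXBn : (X.map (portIncl P E) ++ B).Nodup :=
    hn.sublist (List.Sublist.append_left (List.sublist_append_right _ _) _)
  -- `XB` and `X'A` are both bases of `A ∪ P`.
  have h3 : X.length + B.length = X'.length + A.card := by
    have hb : χ.matroid.IsBasis {x | x ∈ X'.map (portIncl P E) ++ A.toList.map Sum.inr}
        (Sum.inr '' (A : Set E) ∪ Set.range (portIncl P E)) := by
      refine hbase.isBasis_of_subset (Set.subset_univ _) ?_
      intro x hx
      rcases List.mem_append.1 hx with hx | hx
      · obtain ⟨t, -, rfl⟩ := List.mem_map.1 hx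
        exact Or.inr ⟨t, rfl⟩
      · exact Or.inl (hA.subset hx)
    have h4 := χ.rk_eq_length (χ.alternating.nodup hX') hb
    have h5 := χ.rk_eq_length hXBn hXB
    rw [h4] at h5
    simpa using h5.symm
  have h6 := χ.rank_eq_length hX'
  rw [hr']
  simp only [List.length_append, List.length_map, Finset.length_toList] at hr h6
  omega

variable {K : Type*} [Field K] [DecidableEq P]

/-- Used over `K` to evaluate `M_∅` of the minor, and over `ℚ` to see that the minor is unimodular.
-/
theorem IsUnimodularPresentation.portMinor {N : ExteriorAlgebra K (P ⊕ E → K)}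
    {𝒩 : OrientedMatroid (P ⊕ E)} (h : IsUnimodularPresentation N 𝒩) (A : Finset E)
    (h1 : 𝒩.rank - (𝒩.portMinor A).rank - 𝒩.rk (Sum.inr '' (A : Set E)) = 0)
    (h2 : A.card - 𝒩.rk (Sum.inr '' (A : Set E)) = 0) :
    IsUnimodularPresentation (extMinor (portIncl P E) (A.toList.map Sum.inr) N)
      (𝒩.portMinor A) := by
  obtain ⟨hN, χ, rfl, hc⟩ := h
  obtain ⟨χ', hχ', hX⟩ := χ.exists_portMinor_eq A h1 h2
  exact ⟨hN.extMinor _ _, χ', hχ', fun X => by rw [coord_extMinor, hc, hX]⟩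

theorem IsUnimodularPresentation.extMinor_eq_zero {N : ExteriorAlgebra K (P ⊕ E → K)}
    {𝒩 : OrientedMatroid (P ⊕ E)} (h : IsUnimodularPresentation N 𝒩) (A : Finset E)
    (hA : ¬ (𝒩.rank - (𝒩.portMinor A).rank - 𝒩.rk (Sum.inr '' (A : Set E)) = 0 ∧
      A.card - 𝒩.rk (Sum.inr '' (A : Set E)) = 0)) :
    extMinor (portIncl P E) (A.toList.map Sum.inr) N = 0 := by
  obtain ⟨hN, χ, rfl, hc⟩ := h
  refine eq_of_coord_eq fun X => ?_
  rw [coord_extMinor, hc, map_zero]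
  by_cases hX : χ.toFun (X.map (portIncl P E) ++ A.toList.map Sum.inr) = 0
  · rw [hX, SignType.coe_zero]
  · exact (hA (χ.exponents_eq_zero A hX)).elim

variable [DecidableEq E]

theorem extME_zero (ε : GroundSetOrientation (P ⊕ E)) (g r : E → K) (e : List E) :
    extME ε g r e (0 : ExteriorAlgebra K (P ⊕ E → K)) = 0 := by
  rw [extME, extM, map_zero, zero_mul]
  exact map_zero (extMinorLinear Sum.inl (e.map Sum.inr))

end PortMinor

/-! ### An oriented matroid is determined by its connected components -/

namespace OrientedMatroid

variable {S : Type*} [Finite S] (𝒩 : OrientedMatroid S)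

theorem coe_rk (A : Set S) : (𝒩.rk A : ℕ∞) = 𝒩.matroid.eRk A := by
  refine ENat.natCast_toNat ?_
  have h := 𝒩.matroid.eRk_le_encard A
  have h' := (Set.encard_lt_top_iff (s := A)).2 (Set.toFinite A)
  exact (h.trans_lt h').ne

theorem rk_submod (A B : Set S) : 𝒩.rk (A ∩ B) + 𝒩.rk (A ∪ B) ≤ 𝒩.rk A + 𝒩.rk B := by
  have := 𝒩.matroid.eRk_submod A B
  simp only [← coe_rk] at this
  exact_mod_cast this

theorem rk_empty : 𝒩.rk ∅ = 0 := by
  simp [rk]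

theorem rank_le_add_compl (A : Set S) : 𝒩.rank ≤ 𝒩.rk A + 𝒩.rk Aᶜ := by
  have := 𝒩.rk_submod A Aᶜ
  rw [Set.union_compl_self] at this
  exact (Nat.le_add_left _ _).trans this

theorem isSeparator_univ [Fintype S] : 𝒩.IsSeparator Finset.univ := by
  simp [IsSeparator, rk_empty, rank]

theorem mem_components [Fintype S] (T : Finset S) : T ∈ 𝒩.components ↔
    Minimal (fun T : Finset S => T.Nonempty ∧ 𝒩.IsSeparator T) T := by
  simp [components]

/-- Submodularity is applied to the pairs `U, Tᶜ` and `Uᶜ, T`. The right sides add up to `2ρ`, while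
the left sides regroup into two complementary pairs, each of rank sum at least `ρ`; equality holds
throughout. -/
theorem IsSeparator.sdiff [DecidableEq S] {𝒩 : OrientedMatroid S} {U T : Finset S}
    (hU : 𝒩.IsSeparator U) (hT : 𝒩.IsSeparator T) : 𝒩.IsSeparator (U \ T) := by
  unfold IsSeparator at *
  have h1 := 𝒩.rk_submod (U : Set S) (T : Set S)ᶜ
  have h2 := 𝒩.rk_submod (U : Set S)ᶜ (T : Set S)
  have h3 := 𝒩.rank_le_add_compl ((U : Set S) ∩ (T : Set S)ᶜ)
  have h4 := 𝒩.rank_le_add_compl ((U : Set S) ∪ (T : Set S)ᶜ)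
  rw [Set.compl_union, compl_compl] at h4
  rw [Finset.coe_sdiff, Set.sdiff_eq]
  rw [Set.compl_inter, compl_compl] at h3 ⊢
  omega

end OrientedMatroid

/-! ### Factorization of a chirotope across a separator -/

namespace Chirotope

variable {S : Type*}

/-- The exchange relation when only one term of the exchange does not vanish. -/
theorem mul_exchange (χ : Chirotope S) (a y : S) (X V : List S)
    (h : ∀ v ∈ V, χ.toFun (v :: X) = 0) :
    χ.toFun (a :: X) * χ.toFun (y :: V) = χ.toFun (y :: X) * χ.toFun (a :: V) := by
  have key : ∀ a y, 0 ≤ χ.toFun (y :: X) * χ.toFun (a :: V) →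
      0 ≤ χ.toFun (a :: X) * χ.toFun (y :: V) := by
    intro a y h0
    refine χ.exchange a X (y :: V) ?_
    rintro (_ | ⟨y₁, Y₁⟩) y' Y₂ hY
    · simp only [List.nil_append, List.cons.injEq] at hY
      obtain ⟨rfl, rfl⟩ := hY
      exact h0
    · simp only [List.cons_append, List.cons.injEq] at hY
      rw [h y' (by rw [hY.2]; simp), zero_mul]
  cases V with
  | nil =>
    cases X with
    | nil => exact mul_comm _ _
    | cons x X =>
      have h0 : ∀ b c, χ.toFun (b :: x :: X) * χ.toFun [c] = 0 := by
        intro b c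
        by_contra hne
        have := χ.length_eq _ _ (left_ne_zero_of_mul hne) (right_ne_zero_of_mul hne)
        simp at this
      rw [h0, h0]
  | cons v V =>
    -- Exchanging the first two entries of the second sequence negates both products, so
    -- non-positivity transfers as well. With `a` and `y` interchanged, these implications force
    -- equality of signs.
    have key' : ∀ a y, 0 ≤ -(χ.toFun (y :: X) * χ.toFun (a :: v :: V)) →
        0 ≤ -(χ.toFun (a :: X) * χ.toFun (y :: v :: V)) := by
      intro a y h0
      have hs : ∀ b, χ.toFun (b :: v :: V) = -χ.toFun (v :: b :: V) :=
        fun b => χ.alternating.swap [] b v V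
      rw [hs, mul_neg, neg_neg] at h0 ⊢
      refine χ.exchange a X (v :: y :: V) ?_
      rintro (_ | ⟨y₁, _ | ⟨y₂, Y₁⟩⟩) y' Y₂ hY
      · simp only [List.nil_append, List.cons.injEq] at hY
        rw [h y' (by rw [← hY.1]; simp), zero_mul]
      · simp only [List.cons_append, List.nil_append, List.cons.injEq] at hY
        obtain ⟨rfl, rfl, rfl⟩ := hY
        exact h0
      · simp only [List.cons_append, List.cons.injEq] at hY
        rw [h y' (by rw [hY.2.2]; simp), zero_mul]
    have h1 := key a y
    have h2 := key y a
    have h3 := key' a y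
    have h4 := key' y a
    revert h1 h2 h3 h4
    generalize χ.toFun (a :: X) * χ.toFun (y :: v :: V) = s
    generalize χ.toFun (y :: X) * χ.toFun (a :: v :: V) = t
    revert s t
    decide

/-- The sign is common to all chirotopes and all tails, as comparing different tails or two
chirotopes requires. -/
theorem append_eq_or_neg_of_perm {X X' : List S} (h : X.Perm X') :
    (∀ (χ : Chirotope S) W, χ.toFun (X ++ W) = χ.toFun (X' ++ W)) ∨
      (∀ (χ : Chirotope S) W, χ.toFun (X ++ W) = -χ.toFun (X' ++ W)) := by
  have halt : ∀ (χ : Chirotope S) W, AltOn (fun L : List S => χ.toFun (L ++ W)) := by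
    intro χ W
    simpa using χ.alternating.altOn.context [] id W
  exact (AltOn.perm_common (M := SignType) h).imp (fun h χ W => h _ (halt χ W))
    (fun h χ W => h _ (halt χ W))

variable [Finite S]

theorem le_rk_of_subset (χ : Chirotope S) {A L : List S} (hA : χ.toFun A ≠ 0) (hL : L.Nodup)
    (hLA : L ⊆ A) {C : Set S} (hLC : ∀ x ∈ L, x ∈ C) :
    L.length ≤ (OrientedMatroid.ofChirotope χ).rk C := by
  have h1 : χ.matroid.Indep {x | x ∈ L} := (χ.isBase_of_ne_zero hA).indep.subset fun x hx => hLA hx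
  have h2 : χ.matroid.eRk {x | x ∈ L} ≤ χ.matroid.eRk C := χ.matroid.eRk_mono hLC
  rw [h1.eRk_eq_encard, hL.encard_setOf_mem] at h2
  have h3 := (OrientedMatroid.ofChirotope χ).coe_rk C
  rw [← Nat.cast_le (α := ℕ∞), h3]
  exact h2

/-- A nonvanishing sequence has `ρ(T)` entries in a separator `T`. -/
theorem length_eq_of_isSeparator (χ : Chirotope S) {T : Finset S}
    (hT : (OrientedMatroid.ofChirotope χ).IsSeparator T) {X D : List S}
    (hX : ∀ x ∈ X, x ∈ T) (hD : ∀ x ∈ D, x ∉ T) (h : χ.toFun (X ++ D) ≠ 0) :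
    X.length = (OrientedMatroid.ofChirotope χ).rk (T : Set S) := by
  have hn := List.nodup_append'.1 (χ.alternating.nodup h)
  -- `|X| ≤ ρ(T)` and `|D| ≤ ρ(Tᶜ)`, and both sides have the same sum `ρ`.
  have h1 := χ.le_rk_of_subset h hn.1 (List.subset_append_left _ _) (C := (T : Set S)) hX
  have h2 := χ.le_rk_of_subset h hn.2.1 (List.subset_append_right _ _) (C := (T : Set S)ᶜ) hD
  have h3 := χ.rank_eq_length h
  rw [List.length_append] at h3
  unfold OrientedMatroid.IsSeparator at hT
  omega

/-- Induction on the number of entries of `X` outside `Y`: one such entry is exchanged for an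
element of `Y`, with the same effect for the tails `D` and `W`. -/
theorem mul_eq_mul_of_ne_zero [DecidableEq S] (χ : Chirotope S) {T : Finset S}
    (hT : (OrientedMatroid.ofChirotope χ).IsSeparator T) {D W Y : List S}
    (hY : ∀ x ∈ Y, x ∈ T) (hD : ∀ x ∈ D, x ∉ T) (hW : ∀ x ∈ W, x ∉ T)
    (hYW : χ.toFun (Y ++ W) ≠ 0) (n : ℕ) :
    ∀ X : List S, (∀ x ∈ X, x ∈ T) → X.countP (fun x => x ∉ Y) ≤ n →
      χ.toFun (X ++ D) ≠ 0 →
      χ.toFun (X ++ D) * χ.toFun (Y ++ W) = χ.toFun (X ++ W) * χ.toFun (Y ++ D) := by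
  induction n with
  | zero =>
    intro X hX hn hXD
    have hsub : X ⊆ Y := by
      intro x hx
      have := List.countP_eq_zero.1 (Nat.le_zero.1 hn) x hx
      simpa using this
    have hlen := (χ.length_eq_of_isSeparator hT hX hD hXD).trans
      (χ.length_eq_of_isSeparator hT hY hW hYW).symm
    have hperm : X.Perm Y := ((List.nodup_append'.1 (χ.alternating.nodup hXD)).1.subperm
      hsub).perm_of_length_le hlen.ge
    rcases append_eq_or_neg_of_perm hperm with h | h
    · rw [h, h, mul_comm]
    · rw [h, h, neg_mul, neg_mul, mul_comm]
  | succ n ih =>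
    intro X hX hn hXD
    by_cases hx : ∃ x ∈ X, x ∉ Y
    swap
    · refine ih X hX ?_ hXD
      rw [List.countP_eq_zero.2 (fun x hxX => by simpa using fun h => hx ⟨x, hxX, h⟩)]
      exact Nat.zero_le _
    obtain ⟨x, hxX, hxY⟩ := hx
    obtain ⟨X', hp⟩ : ∃ X', X.Perm (x :: X') := by
      obtain ⟨s, t, rfl⟩ := List.append_of_mem hxX
      exact ⟨s ++ t, List.perm_middle⟩
    suffices h : χ.toFun (x :: X' ++ D) * χ.toFun (Y ++ W) =
        χ.toFun (x :: X' ++ W) * χ.toFun (Y ++ D) by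
      rcases append_eq_or_neg_of_perm hp with h' | h'
      · rw [h', h', h]
      · rw [h', h', neg_mul, neg_mul, h]
    have hxD : χ.toFun (x :: X' ++ D) ≠ 0 := by
      rcases append_eq_or_neg_of_perm hp with h' | h' <;> rw [h'] at hXD <;> simpa using hXD
    have hX' : ∀ y ∈ X', y ∈ T := fun y hy => hX y (hp.mem_iff.2 (List.mem_cons_of_mem _ hy))
    have hxT : x ∈ T := hX x hxX
    rw [hp.countP_eq, List.countP_cons_of_pos (by simpa using hxY)] at hn
    have hlen : X'.length + 1 = _ := χ.length_eq_of_isSeparator hT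
      (X := x :: X') (fun y hy => hX y (hp.mem_iff.2 hy)) hD hxD
    -- Replacing `x` by an element outside `T` would leave too few entries in `T`.
    have hzero : ∀ w, w ∉ T → χ.toFun (w :: (X' ++ D)) = 0 := by
      intro w hw
      by_contra hne
      rcases χ.alternating.altOn.eq_or_neg_of_perm
        (List.perm_middle (a := w) (l₁ := X') (l₂ := D)) with h | h
      all_goals
        have hne' : χ.toFun (X' ++ w :: D) ≠ 0 := by rw [h]; simpa using hne
        have := χ.length_eq_of_isSeparator hT hX' (D := w :: D) (by simpa [hw] using hD) hne'
        omega
    -- Some entry of `YW` can replace `x`, and by `hzero` it does not come from `W`.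
    obtain ⟨y, hy, hyD⟩ : ∃ y ∈ Y, χ.toFun (y :: X' ++ D) ≠ 0 := by
      by_contra! hcon
      have hall : ∀ v ∈ Y ++ W, χ.toFun (v :: (X' ++ D)) = 0 := by
        intro v hv
        rcases List.mem_append.1 hv with hv | hv
        · exact hcon v hv
        · exact hzero v (hW v hv)
      have hl := χ.length_eq _ _ hxD hYW
      cases hV : Y ++ W with
      | nil => rw [hV] at hl; simp at hl
      | cons v V =>
        rw [hV] at hall hYW
        have := χ.mul_exchange x v (X' ++ D) V fun u hu => hall u (by simp [hu])
        rw [hall v (by simp), zero_mul] at this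
        exact mul_ne_zero hxD hYW this
    have h1 := ih (y :: X') (by simpa [hY y hy] using hX')
      (by rw [List.countP_cons_of_neg (by simpa using hy)]; omega) hyD
    -- All other exchange terms vanish: entries of `X'` would be repeated, and entries of `W` fall
    -- under `hzero`.
    have h2 : χ.toFun (x :: X' ++ D) * χ.toFun (y :: X' ++ W) =
        χ.toFun (y :: X' ++ D) * χ.toFun (x :: X' ++ W) := by
      refine χ.mul_exchange x y (X' ++ D) (X' ++ W) fun v hv => ?_
      rcases List.mem_append.1 hv with hv | hv
      · exact χ.alternating.altOn.zero _ (by simp [hv])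
      · exact hzero v (hW v hv)
    have h3 : χ.toFun (y :: X' ++ W) ≠ 0 :=
      left_ne_zero_of_mul (h1 ▸ mul_ne_zero hyD hYW)
    refine mul_right_cancel₀ (mul_ne_zero hyD h3) ?_
    calc _ = (χ.toFun (x :: X' ++ D) * χ.toFun (y :: X' ++ W)) *
          (χ.toFun (y :: X' ++ D) * χ.toFun (Y ++ W)) := by ac_rfl
      _ = _ := by rw [h2, h1]; ac_rfl

/-- A chirotope is a product with respect to a separator. -/
theorem mul_eq_mul_of_isSeparator (χ : Chirotope S) {T : Finset S}
    (hT : (OrientedMatroid.ofChirotope χ).IsSeparator T) {X Y D W : List S}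
    (hX : ∀ x ∈ X, x ∈ T) (hY : ∀ x ∈ Y, x ∈ T) (hD : ∀ x ∈ D, x ∉ T) (hW : ∀ x ∈ W, x ∉ T) :
    χ.toFun (X ++ D) * χ.toFun (Y ++ W) = χ.toFun (X ++ W) * χ.toFun (Y ++ D) := by
  classical
  by_cases h : χ.toFun (X ++ D) * χ.toFun (Y ++ W) = 0
  · by_cases h' : χ.toFun (X ++ W) * χ.toFun (Y ++ D) = 0
    · rw [h, h']
    · exact (χ.mul_eq_mul_of_ne_zero hT hY hW hD (right_ne_zero_of_mul h') _ X hX le_rfl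
        (left_ne_zero_of_mul h')).symm
  · exact χ.mul_eq_mul_of_ne_zero hT hY hD hW (right_ne_zero_of_mul h) _ X hX le_rfl
      (left_ne_zero_of_mul h)

/-- Two chirotopes define the same oriented matroid on `U`, where `U` is a separator of both. -/
def Compat (χ ψ : Chirotope S) (U : Finset S) : Prop :=
  ∀ W W' X₀ X₀' : List S, (∀ x ∈ W, x ∉ U) → (∀ x ∈ W', x ∉ U) → (∀ x ∈ X₀, x ∈ U) →
    (∀ x ∈ X₀', x ∈ U) → χ.toFun (X₀ ++ W) ≠ 0 → ψ.toFun (X₀' ++ W') ≠ 0 →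
    ∀ X Y : List S, (∀ x ∈ X, x ∈ U) → (∀ x ∈ Y, x ∈ U) →
      χ.toFun (X ++ W) * χ.toFun (Y ++ W) = ψ.toFun (X ++ W') * ψ.toFun (Y ++ W')

omit [Finite S] in
theorem Compat.symm {χ ψ : Chirotope S} {U : Finset S} (h : Compat χ ψ U) : Compat ψ χ U :=
  fun W W' X₀ X₀' hW hW' hX₀ hX₀' h₀ h₀' X Y hX hY =>
    (h W' W X₀' X₀ hW' hW hX₀' hX₀ h₀' h₀ X Y hX hY).symm

theorem _root_.SignType.mul_self_of_ne_zero {s : SignType} (h : s ≠ 0) : s * s = 1 := by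
  revert s; decide

theorem exists_restrict_eq (χ : Chirotope S) {T : Finset S} :
    ∃ (D X₀ : List S), (∀ x ∈ D, x ∉ T) ∧ (∀ x ∈ X₀, x ∈ T) ∧ χ.toFun (X₀ ++ D) ≠ 0 ∧
      ∀ X : List T, (χ.minor Subtype.val ∅).toFun X = χ.toFun (X.map Subtype.val ++ D) := by
  obtain ⟨Z, ⟨X, D, B, rfl, hn, hB, hXB, hX⟩, hm⟩ := χ.exists_minor_eq (Subtype.val : T → S) ∅
  obtain rfl : B = [] := by
    rw [List.eq_nil_iff_forall_not_mem]
    exact fun x hx => hB.subset hx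
  simp only [List.append_nil, Set.empty_union] at *
  have hne := (χ.matroid_isBase _ hn).1 hX
  have hnX := List.nodup_append'.1 hn
  have hXT : ∀ x ∈ X.map Subtype.val, x ∈ T := by
    intro x hx
    obtain ⟨t, -, rfl⟩ := List.mem_map.1 hx
    exact t.2
  refine ⟨D, X.map Subtype.val, fun d hd hdT => ?_, hXT, hne, hm⟩
  have h1 := χ.rk_eq_length hnX.1 hXB
  -- If `d` were in `T`, adjoining it to the basis `X` of `T` would give a larger independent subset
  -- of `T`.
  have h2 := χ.le_rk_of_subset hne (L := d :: X.map Subtype.val)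
    (List.nodup_cons.2 ⟨fun h => hnX.2.2 h hd, hnX.1⟩)
    (List.cons_subset.2 ⟨List.mem_append_right _ hd, List.subset_append_left _ _⟩)
    (C := (T : Set S)) (by
      intro x hx
      rcases List.mem_cons.1 hx with rfl | hx
      · exact hdT
      · exact hXT x hx)
  have h3 : (OrientedMatroid.ofChirotope χ).rk (T : Set S) = (X.map Subtype.val).length := by
    rw [← h1]
    congr 1
    ext; simp
  rw [h3, List.length_cons] at h2
  omega

/-- The oriented matroid on a separator does not depend on the completing tail: insert the square of
`χ(X₁D)` and interchange tails by `mul_eq_mul_of_isSeparator`. -/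
theorem mul_eq_mul_of_complete (χ : Chirotope S) {T : Finset S}
    (hT : (OrientedMatroid.ofChirotope χ).IsSeparator T) {X Y X₀ X₁ D W : List S}
    (hX : ∀ x ∈ X, x ∈ T) (hY : ∀ x ∈ Y, x ∈ T) (hX₀ : ∀ x ∈ X₀, x ∈ T)
    (hX₁ : ∀ x ∈ X₁, x ∈ T) (hD : ∀ x ∈ D, x ∉ T) (hW : ∀ x ∈ W, x ∉ T)
    (hW₀ : χ.toFun (X₀ ++ W) ≠ 0) (hD₁ : χ.toFun (X₁ ++ D) ≠ 0) :
    χ.toFun (X ++ W) * χ.toFun (Y ++ W) = χ.toFun (X ++ D) * χ.toFun (Y ++ D) := by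
  have h1 := χ.mul_eq_mul_of_isSeparator hT hX₁ hX₀ hD hW
  have hW₁ : χ.toFun (X₁ ++ W) ≠ 0 := left_ne_zero_of_mul (h1 ▸ mul_ne_zero hD₁ hW₀)
  have h2 := χ.mul_eq_mul_of_isSeparator hT hX hX₁ hW hD
  have h3 := χ.mul_eq_mul_of_isSeparator hT hY hX₁ hW hD
  calc _ = (χ.toFun (X ++ W) * χ.toFun (X₁ ++ D)) * (χ.toFun (Y ++ W) * χ.toFun (X₁ ++ D)) := by
        rw [mul_mul_mul_comm, SignType.mul_self_of_ne_zero hD₁, mul_one]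
    _ = _ := by
        rw [h2, h3, mul_mul_mul_comm, SignType.mul_self_of_ne_zero hW₁, mul_one]

theorem compat_of_restrict_eq {χ ψ : Chirotope S} {T : Finset S}
    (hχ : (OrientedMatroid.ofChirotope χ).IsSeparator T)
    (hψ : (OrientedMatroid.ofChirotope ψ).IsSeparator T)
    (h : (OrientedMatroid.ofChirotope χ).restrict T = (OrientedMatroid.ofChirotope ψ).restrict T) :
    Compat χ ψ T := by
  intro W W' X₀ X₀' hW hW' hX₀ hX₀' h₀ h₀' X Y hX hY
  obtain ⟨D, X₁, hD, hX₁, h₁, hm⟩ := χ.exists_restrict_eq (T := T)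
  obtain ⟨D', X₁', hD', hX₁', h₁', hm'⟩ := ψ.exists_restrict_eq (T := T)
  rw [χ.mul_eq_mul_of_complete hχ hX hY hX₀ hX₁ hD hW h₀ h₁,
    ψ.mul_eq_mul_of_complete hψ hX hY hX₀' hX₁' hD' hW' h₀' h₁']
  lift X to List T using hX
  lift Y to List T using hY
  rw [← hm, ← hm, ← hm', ← hm']
  rcases Quotient.exact h with h | h
  · rw [h]
  · rw [h]
    exact neg_mul_neg _ _

omit [Finite S] in
theorem mul_eq_mul_of_perm {χ ψ : Chirotope S} {X X' Y Y' W W' : List S} (hX : X.Perm X')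
    (hY : Y.Perm Y') (h : χ.toFun (X' ++ W) * χ.toFun (Y' ++ W) =
      ψ.toFun (X' ++ W') * ψ.toFun (Y' ++ W')) :
    χ.toFun (X ++ W) * χ.toFun (Y ++ W) = ψ.toFun (X ++ W') * ψ.toFun (Y ++ W') := by
  rcases append_eq_or_neg_of_perm hX with h1 | h1 <;>
    rcases append_eq_or_neg_of_perm hY with h2 | h2 <;>
    simp only [h1, h2, neg_mul, mul_neg, h]

/-- From `X₁X₂` to `Y₁Y₂`, change the `T` part and then the `V` part. The intermediate sequence is
`Y₁X₂` for `χ`. For `ψ` the first change is made beside `Z₂`, where a non-zero value is known, and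
the factorization of `ψ` across `T` removes `Z₂` at the end. -/
theorem Compat.union_aux {χ ψ : Chirotope S} {T V : Finset S} (hTV : ∀ x ∈ T, x ∉ V)
    (hχT : (OrientedMatroid.ofChirotope χ).IsSeparator T)
    (hψT : (OrientedMatroid.ofChirotope ψ).IsSeparator T)
    (hT : Compat χ ψ T) (hV : Compat χ ψ V) {W W' X₁ X₂ Y₁ Y₂ Z₁ Z₂ : List S}
    (hW : ∀ x ∈ W, x ∉ T ∧ x ∉ V) (hW' : ∀ x ∈ W', x ∉ T ∧ x ∉ V)
    (hX₁ : ∀ x ∈ X₁, x ∈ T) (hX₂ : ∀ x ∈ X₂, x ∈ V) (hY₁ : ∀ x ∈ Y₁, x ∈ T)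
    (hY₂ : ∀ x ∈ Y₂, x ∈ V) (hZ₁ : ∀ x ∈ Z₁, x ∈ T) (hZ₂ : ∀ x ∈ Z₂, x ∈ V)
    (hZ : ψ.toFun (Z₁ ++ Z₂ ++ W') ≠ 0)
    (hne : χ.toFun (X₁ ++ X₂ ++ W) * χ.toFun (Y₁ ++ Y₂ ++ W) ≠ 0) :
    χ.toFun (X₁ ++ X₂ ++ W) * χ.toFun (Y₁ ++ Y₂ ++ W) =
      ψ.toFun (X₁ ++ X₂ ++ W') * ψ.toFun (Y₁ ++ Y₂ ++ W') := by
  have hVT : ∀ {A : List S}, (∀ x ∈ A, x ∈ V) → ∀ {B : List S}, (∀ x ∈ B, x ∉ T ∧ x ∉ V) →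
      ∀ x ∈ A ++ B, x ∉ T := by
    intro A hA B hB x hx hxT
    rcases List.mem_append.1 hx with hx | hx
    · exact hTV x hxT (hA x hx)
    · exact (hB x hx).1 hxT
  have hTV' : ∀ {A : List S}, (∀ x ∈ A, x ∈ T) → ∀ {B : List S}, (∀ x ∈ B, x ∉ T ∧ x ∉ V) →
      ∀ x ∈ A ++ B, x ∉ V := by
    intro A hA B hB x hx hxV
    rcases List.mem_append.1 hx with hx | hx
    · exact hTV x (hA x hx) hxV
    · exact (hB x hx).2 hxV
  have ne_comm : ∀ (φ : Chirotope S) (A B C : List S), φ.toFun (A ++ B ++ C) ≠ 0 →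
      φ.toFun (B ++ (A ++ C)) ≠ 0 := fun φ A B C =>
    φ.alternating.ne_zero_of_perm (by
      rw [List.append_assoc]; exact List.perm_append_comm_assoc _ _ _)
  have hc : χ.toFun (Y₁ ++ X₂ ++ W) ≠ 0 := by
    have := χ.mul_eq_mul_of_isSeparator hχT hX₁ hY₁ (hVT hX₂ hW) (hVT hY₂ hW)
    simp only [← List.append_assoc] at this
    exact right_ne_zero_of_mul (this ▸ hne)
  have h1 := hT (X₂ ++ W) (Z₂ ++ W') X₁ Z₁ (hVT hX₂ hW) (hVT hZ₂ hW') hX₁ hZ₁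
    (by rw [← List.append_assoc]; exact left_ne_zero_of_mul hne)
    (by rwa [← List.append_assoc]) X₁ Y₁ hX₁ hY₁
  simp only [← List.append_assoc] at h1
  have hq : ψ.toFun (Y₁ ++ Z₂ ++ W') ≠ 0 :=
    right_ne_zero_of_mul (h1 ▸ mul_ne_zero (left_ne_zero_of_mul hne) hc)
  have h2 := hV (Y₁ ++ W) (Y₁ ++ W') X₂ Z₂ (hTV' hY₁ hW) (hTV' hY₁ hW') hX₂ hZ₂
    (ne_comm _ _ _ _ hc) (ne_comm _ _ _ _ hq) X₂ Y₂ hX₂ hY₂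
  simp only [← List.append_assoc] at h2
  have h2' := mul_eq_mul_of_perm (List.perm_append_comm (l₁ := Y₁) (l₂ := X₂))
    (List.perm_append_comm (l₁ := Y₁) (l₂ := Y₂)) h2
  have h3 := ψ.mul_eq_mul_of_isSeparator hψT hX₁ hY₁ (hVT hZ₂ hW') (hVT hX₂ hW')
  simp only [← List.append_assoc] at h3
  calc _ = (χ.toFun (X₁ ++ X₂ ++ W) * χ.toFun (Y₁ ++ X₂ ++ W)) *
        (χ.toFun (Y₁ ++ X₂ ++ W) * χ.toFun (Y₁ ++ Y₂ ++ W)) := by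
        rw [mul_assoc, ← mul_assoc (χ.toFun (Y₁ ++ X₂ ++ W)), SignType.mul_self_of_ne_zero hc,
          one_mul]
    _ = (ψ.toFun (X₁ ++ Z₂ ++ W') * ψ.toFun (Y₁ ++ X₂ ++ W')) *
        (ψ.toFun (Y₁ ++ Z₂ ++ W') * ψ.toFun (Y₁ ++ Y₂ ++ W')) := by
        rw [h1, h2', mul_mul_mul_comm]
    _ = _ := by
        rw [h3, mul_assoc, ← mul_assoc (ψ.toFun (Y₁ ++ Z₂ ++ W')),
          SignType.mul_self_of_ne_zero hq, one_mul]

omit [Finite S] in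
theorem exists_perm_append [DecidableEq S] {T V : Finset S} {X : List S}
    (hX : ∀ x ∈ X, x ∈ T ∪ V) : ∃ X₁ X₂ : List S, (∀ x ∈ X₁, x ∈ T) ∧ (∀ x ∈ X₂, x ∈ V) ∧
      X.Perm (X₁ ++ X₂) := by
  refine ⟨X.filter (· ∈ T), X.filter (fun x => !decide (x ∈ T)), ?_, ?_,
    (List.filter_append_perm _ _).symm⟩
  · simp
  · intro x hx
    simp only [List.mem_filter, Bool.not_eq_true', decide_eq_false_iff_not] at hx
    exact (Finset.mem_union.1 (hX x hx.1)).resolve_left hx.2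

theorem Compat.union [DecidableEq S] {χ ψ : Chirotope S} {T V : Finset S}
    (hTV : ∀ x ∈ T, x ∉ V)
    (hχT : (OrientedMatroid.ofChirotope χ).IsSeparator T)
    (hψT : (OrientedMatroid.ofChirotope ψ).IsSeparator T)
    (hT : Compat χ ψ T) (hV : Compat χ ψ V) : Compat χ ψ (T ∪ V) := by
  intro W W' X₀ X₀' hW hW' hX₀ hX₀' h₀ h₀' X Y hX hY
  obtain ⟨X₁, X₂, hX₁, hX₂, hpX⟩ := exists_perm_append hX
  obtain ⟨Y₁, Y₂, hY₁, hY₂, hpY⟩ := exists_perm_append hY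
  obtain ⟨Z₁, Z₂, hZ₁, hZ₂, hpZ⟩ := exists_perm_append hX₀
  obtain ⟨Z₁', Z₂', hZ₁', hZ₂', hpZ'⟩ := exists_perm_append hX₀'
  replace h₀ := χ.alternating.ne_zero_of_perm (hpZ.append_right W) h₀
  replace h₀' := ψ.alternating.ne_zero_of_perm (hpZ'.append_right W') h₀'
  simp only [Finset.mem_union, not_or] at hW hW'
  refine mul_eq_mul_of_perm hpX hpY ?_
  by_cases h : χ.toFun (X₁ ++ X₂ ++ W) * χ.toFun (Y₁ ++ Y₂ ++ W) = 0
  · by_cases h' : ψ.toFun (X₁ ++ X₂ ++ W') * ψ.toFun (Y₁ ++ Y₂ ++ W') = 0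
    · rw [h, h']
    · exact (Compat.union_aux hTV hψT hχT hT.symm hV.symm hW' hW hX₁ hX₂ hY₁ hY₂ hZ₁ hZ₂
        h₀ h').symm
  · exact Compat.union_aux hTV hχT hψT hT hV hW hW' hX₁ hX₂ hY₁ hY₂ hZ₁' hZ₂' h₀' h

/-- Strong induction on the separator: a component inside `U` is split off, and the rest is again a
separator of both. -/
theorem compat_of_components {S : Type*} [Fintype S] [DecidableEq S] {χ ψ : Chirotope S}
    (hc : (OrientedMatroid.ofChirotope χ).components = (OrientedMatroid.ofChirotope ψ).components)
    (hr : ∀ T ∈ (OrientedMatroid.ofChirotope χ).components,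
      (OrientedMatroid.ofChirotope χ).restrict T = (OrientedMatroid.ofChirotope ψ).restrict T)
    (U : Finset S) : (OrientedMatroid.ofChirotope χ).IsSeparator U →
      (OrientedMatroid.ofChirotope ψ).IsSeparator U → Compat χ ψ U := by
  induction U using Finset.strongInduction with
  | H U ih =>
    intro hχ hψ
    rcases U.eq_empty_or_nonempty with rfl | hU
    · intro W W' X₀ X₀' hW hW' hX₀ hX₀' h₀ h₀' X Y hX hY
      have hnil : ∀ {X : List S}, (∀ x ∈ X, x ∈ (∅ : Finset S)) → X = [] := fun h =>
        List.eq_nil_iff_forall_not_mem.2 fun x hx => Finset.notMem_empty x (h x hx)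
      rw [hnil hX, hnil hY]
      rw [hnil hX₀] at h₀
      rw [hnil hX₀'] at h₀'
      rw [SignType.mul_self_of_ne_zero h₀, SignType.mul_self_of_ne_zero h₀']
    · obtain ⟨T, hTU, hT⟩ := exists_minimal_le_of_wellFoundedLT
        (fun T : Finset S => T.Nonempty ∧ (OrientedMatroid.ofChirotope χ).IsSeparator T) U ⟨hU, hχ⟩
      have hTc : T ∈ (OrientedMatroid.ofChirotope χ).components :=
        (OrientedMatroid.mem_components _ T).2 hT
      have hψT : (OrientedMatroid.ofChirotope ψ).IsSeparator T :=
        ((OrientedMatroid.mem_components _ T).1 (hc ▸ hTc)).prop.2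
      have hV := ih (U \ T) (Finset.sdiff_ssubset hTU hT.prop.1) (hχ.sdiff hT.prop.2)
        (hψ.sdiff hψT)
      have := Compat.union (fun x hx => by simp [hx]) hT.prop.2 hψT
        (compat_of_restrict_eq hT.prop.2 hψT (hr T hTc)) hV
      rwa [Finset.union_sdiff_of_subset hTU] at this

end Chirotope

theorem OrientedMatroid.eq_of_components {S : Type*} [Fintype S] {𝒩 𝒩' : OrientedMatroid S}
    (hc : 𝒩.components = 𝒩'.components)
    (hr : ∀ T ∈ 𝒩.components, 𝒩.restrict T = 𝒩'.restrict T) : 𝒩 = 𝒩' := by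
  classical
  induction 𝒩 using Quotient.inductionOn with | _ χ
  induction 𝒩' using Quotient.inductionOn with | _ ψ
  have h := Chirotope.compat_of_components (χ := χ) (ψ := ψ) hc hr Finset.univ
    (OrientedMatroid.isSeparator_univ _) (OrientedMatroid.isSeparator_univ _)
  obtain ⟨X, hX⟩ := χ.exists_ne_zero
  obtain ⟨X', hX'⟩ := ψ.exists_ne_zero
  -- Equality of all pairwise products means equality up to one global sign, fixed by comparing the
  -- values at `X`.
  have h' : ∀ Y Z, χ.toFun Y * χ.toFun Z = ψ.toFun Y * ψ.toFun Z := by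
    intro Y Z
    simpa using h [] [] X X' (by simp) (by simp) (by simp) (by simp) (by simpa using hX)
      (by simpa using hX') Y Z (by simp) (by simp)
  refine Quotient.sound ?_
  have h1 := h' X X
  have key : ∀ a b c d : SignType, a ≠ 0 → a * a = b * b → a * c = b * d →
      (a = b → c = d) ∧ (a ≠ b → c = -d) := by decide
  by_cases hs : χ.toFun X = ψ.toFun X
  · exact Or.inl (Chirotope.ext (funext fun Y => (key _ _ _ _ hX h1 (h' X Y)).1 hs))
  · exact Or.inr (Chirotope.ext (funext fun Y => (key _ _ _ _ hX h1 (h' X Y)).2 hs))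

/-! ### The monomial of an oriented matroid -/

section Bracket

variable {P : Type*} [Fintype P]

/-- The exponent of the monomial `[𝒩]`. -/
noncomputable def bracketExponent (𝒩 : OrientedMatroid (P ⊕ Empty)) : RVar P →₀ ℕ :=
  ∑ T ∈ 𝒩.components, Finsupp.single (RVar.minor T (𝒩.restrict T)) 1

theorem bracket_eq_monomial (K : Type*) [Field K] (𝒩 : OrientedMatroid (P ⊕ Empty)) :
    bracket K 𝒩 = MvPolynomial.monomial (bracketExponent 𝒩) 1 := by
  rw [bracketExponent, MvPolynomial.monomial_sum_one]
  rfl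

/-- A variable records its ground set `T`, so the exponents identify each component together with
its orientation. -/
theorem bracketExponent_ne_zero_iff (𝒩 : OrientedMatroid (P ⊕ Empty)) (T : Finset (P ⊕ Empty))
    (𝒯 : OrientedMatroid T) :
    bracketExponent 𝒩 (RVar.minor T 𝒯) ≠ 0 ↔ T ∈ 𝒩.components ∧ 𝒩.restrict T = 𝒯 := by
  classical
  rw [bracketExponent, Finsupp.finsetSum_apply, Ne, Finset.sum_eq_zero_iff]
  simp only [Finsupp.single_apply]
  constructor
  · intro h
    push Not at h
    obtain ⟨T', hT', h⟩ := h
    have h' : RVar.minor T' (𝒩.restrict T') = RVar.minor T 𝒯 := by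
      by_contra hne
      exact h (if_neg hne)
    injection h' with h1 h2
    subst h1
    exact ⟨hT', eq_of_heq h2⟩
  · rintro ⟨hT, rfl⟩ h
    simpa using h T hT

theorem bracket_injective (K : Type*) [Field K] {𝒩 𝒩' : OrientedMatroid (P ⊕ Empty)}
    (h : bracket K 𝒩 = bracket K 𝒩') : 𝒩 = 𝒩' := by
  rw [bracket_eq_monomial, bracket_eq_monomial] at h
  have h' := MvPolynomial.monomial_left_injective (one_ne_zero (α := K)) h
  have key : ∀ T, T ∈ 𝒩.components ∧ 𝒩.restrict T = 𝒩.restrict T ↔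
      T ∈ 𝒩'.components ∧ 𝒩'.restrict T = 𝒩.restrict T := fun T => by
    rw [← bracketExponent_ne_zero_iff, ← bracketExponent_ne_zero_iff, h']
  have key' : ∀ T, T ∈ 𝒩.components ∧ 𝒩.restrict T = 𝒩'.restrict T ↔
      T ∈ 𝒩'.components ∧ 𝒩'.restrict T = 𝒩'.restrict T := fun T => by
    rw [← bracketExponent_ne_zero_iff, ← bracketExponent_ne_zero_iff, h']
  refine OrientedMatroid.eq_of_components ?_ fun T hT => ((key T).1 ⟨hT, rfl⟩).2.symm
  ext T
  exact ⟨fun hT => ((key T).1 ⟨hT, rfl⟩).1, fun hT => ((key' T).2 ⟨hT, rfl⟩).1⟩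

end Bracket

/-! ### The main theorem -/

section Main

variable {K : Type*} [Field K] {P E : Type*} [Fintype P] [Fintype E] [DecidableEq P]
  [DecidableEq E]

omit [Fintype E] [DecidableEq E] in
theorem replaceMonomials_bracket (ε : GroundSetOrientation (P ⊕ E)) (p : List P) (e : List E)
    {𝒩 : OrientedMatroid (P ⊕ Empty)} (h : 𝒩.IsUnimodular) :
    replaceMonomials ε p e (bracket K 𝒩) = (portSign ε p e : K) • MEmpty K ε 𝒩 := by
  have hex : ∃ 𝒩' : OrientedMatroid (P ⊕ Empty), 𝒩'.IsUnimodular ∧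
      bracket K 𝒩' = MvPolynomial.monomial (bracketExponent 𝒩) 1 :=
    ⟨𝒩, h, bracket_eq_monomial K 𝒩⟩
  -- Injectivity of the bracket makes the choice in `replaceMonomials` unique.
  have hch : hex.choose = 𝒩 :=
    bracket_injective K (hex.choose_spec.2.trans (bracket_eq_monomial K 𝒩).symm)
  have hm : MvPolynomial.monomial (bracketExponent 𝒩) (1 : K) =
    MvPolynomial.basisMonomials (RVar P) K (bracketExponent 𝒩) := by
    rw [MvPolynomial.coe_basisMonomials]
  rw [bracket_eq_monomial, hm, replaceMonomials, Module.Basis.constr_basis, dif_pos hex, hch]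

omit [DecidableEq P] in
theorem setUVZero_bracket (𝒩 : OrientedMatroid (P ⊕ Empty)) :
    setUVZero (bracket K 𝒩) = bracket K 𝒩 := by
  rw [bracket, map_prod]
  exact Finset.prod_congr rfl fun T _ => MvPolynomial.aeval_X _ _

omit [Fintype E] [DecidableEq E] in
theorem replaceMonomials_setUVZero_term (ε : GroundSetOrientation (P ⊕ E)) (p : List P)
    (e : List E) (𝒩 : OrientedMatroid (P ⊕ Empty)) (c : K) (a b : ℕ) :
    replaceMonomials ε p e (setUVZero (bracket K 𝒩 * MvPolynomial.C c *
      MvPolynomial.X RVar.u ^ a * MvPolynomial.X RVar.v ^ b)) =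
      if a = 0 ∧ b = 0 then c • replaceMonomials ε p e (bracket K 𝒩) else 0 := by
  have hu : setUVZero (MvPolynomial.X RVar.u : MvPolynomial (RVar P) K) = 0 :=
    MvPolynomial.aeval_X _ _
  have hv : setUVZero (MvPolynomial.X RVar.v : MvPolynomial (RVar P) K) = 0 :=
    MvPolynomial.aeval_X _ _
  have hC : setUVZero (MvPolynomial.C c : MvPolynomial (RVar P) K) = MvPolynomial.C c :=
    MvPolynomial.aeval_C _ _
  simp only [map_mul, map_pow, hu, hv, hC, setUVZero_bracket]
  split_ifs with h
  · rw [h.1, h.2, pow_zero, mul_one, mul_one, mul_comm, ← MvPolynomial.smul_eq_C_mul,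
      map_smul]
  · rcases not_and_or.1 h with h | h <;> simp [zero_pow h]

end Main

theorem mainTheorem4 {K : Type*} [Field K] [CharZero K] {P E : Type*} [Fintype P] [Fintype E]
    [DecidableEq P] [DecidableEq E]
    (ε : GroundSetOrientation (P ⊕ E)) (g r : E → K)
    (p : List P) (hp : p.Nodup) (hp' : ∀ x, x ∈ p)
    (e : List E) (he : e.Nodup) (he' : ∀ x, x ∈ e)
    (𝒩 : OrientedMatroid (P ⊕ E)) (h𝒩 : 𝒩.IsUnimodular) :
    (∃ N : ExteriorAlgebra K (P ⊕ E → K), IsUnimodularPresentation N 𝒩) ∧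
    (∀ N : ExteriorAlgebra K (P ⊕ E → K), IsUnimodularPresentation N 𝒩 →
      extME ε g r e N = 𝒩.ME ε g r e) ∧
    (∀ 𝒩' : OrientedMatroid (P ⊕ Empty), 𝒩'.IsUnimodular →
      replaceMonomials ε p e (bracket K 𝒩') = (portSign ε p e : K) • MEmpty K ε 𝒩') ∧
    𝒩.ME ε g r e = replaceMonomials ε p e (setUVZero (corankNullity g r 𝒩)) := by
  obtain ⟨N, hN⟩ := h𝒩.exists_presentation K
  refine ⟨⟨N, hN⟩, fun N hN => hN.extME_eq ε g r e,
    fun 𝒩' h' => replaceMonomials_bracket ε p e h', ?_⟩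
  rw [← hN.extME_eq ε g r e, extME_eq_sum_minors ε g r p hp hp' e he he', corankNullity, map_sum,
    map_sum]
  refine Finset.sum_congr rfl fun A _ => ?_
  rw [replaceMonomials_setUVZero_term]
  split_ifs with hA
  · obtain ⟨N₀, hN₀⟩ := h𝒩
    -- Unimodularity is defined over `ℚ`, so the rational presentation `N₀` is used here and `N`
    -- over `K` for the value.
    have hu : (𝒩.portMinor A).IsUnimodular := ⟨_, hN₀.portMinor A hA.1 hA.2⟩
    rw [replaceMonomials_bracket ε p e hu, (hN.portMinor A hA.1 hA.2).extME_eq]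
    rfl
  -- A positive exponent kills the term of `R(𝒩)`, and the corresponding minor of `N` is zero.
  · rw [hN.extMinor_eq_zero A hA, extME_zero, smul_zero, smul_zero]
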